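/- **Multi-layer preferences.** Let $U$ and $W$ be two disjoint sets of $n$ agents each, let $\ell$ be a number of layers, and in each layer $i\in\{1,\dots,\ell\}$ let each agent $u\in U$ have a linear order $\succ^{(i)}_u$ on $W$ and each agent $w\in W$ a linear order $\succ^{(i)}_w$ on $U$. A *matching* is a set $M$ of pairwise disjoint pairs $\{u,w\}$ with $u\in U$, $w\in W$; if $\{u,w\}\in M$, write $M(u)=w$ and $M(w)=u$. For $\alpha\in\{1,\dots,\ell\}$, a matching $M$ is *$\alpha$-layer individually stable* if for each pair $\{u,w\}\notin M$ with $u\in U$, $w\in W$ there is a set $S\subseteq\{1,\dots,\ell\}$ of $\alpha$ layers such that $u$ is matched and $M(u)\succ^{(i)}_u w$ for all $i\in S$, or $w$ is matched and $M(w)\succ^{(i)}_w u$ for all $i\in S$. The preferences are *uniform in each layer* if in each layer all agents of $U$ have the same preference list and all agents of $W$ have the same preference list. **Problems.** *Individually Stable Marriage* (decision version): given $U$, $W$, the $\ell$ layers of preference lists of all agents, and $\alpha\in\{1,\dots,\ell\}$, is there an $\alpha$-layer individually stable matching? *Graph Isomorphism*: given two finite undirected graphs $G$ and $H$ with the same number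 of vertices and the same number of edges, is there a bijection $f:V(G)\to V(H)$ such that, for all $u,v\in V(G)$, $\{u,v\}\in E(G)$ if and only if $\{f(u),f(v)\}\in E(H)$? **Theorem.** Graph Isomorphism is polynomial-time (many-one) reducible to Individually Stable Marriage restricted to the instances in which the preferences are uniform in each layer, $\ell$ is even, and $\alpha=\ell/2$. That is, there is a function, computable by a Turing machine in time polynomial in the length of the input, which maps each instance $(G,H)$ of Graph Isomorphism to an instance of Individually Stable Marriage with these three properties, such that $G$ and $H$ are isomorphic if and only if the constructed instance has an $\alpha$-layer individually stable matching. (Here graphs are given by adjacency matrices, and preference profiles by listing all preference lists.) -/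

import Mathlib

/-! ## Decision problems and polynomial-time many-one reductions -/

/-- A decision problem: a type of instances, a binary encoding of the instances as words
(distinct instances have distinct words), and the predicate singling out the yes-instances. -/
structure DecisionProblem where
  /-- the instances -/
  Instance : Type
  /-- the word that represents an instance -/
  encode : Instance → List Bool
  /-- a word represents at most one instance -/
  encode_injective : Function.Injective encode
  /-- the yes-instances -/
  IsYes : Instance → Prop

/-- The restriction of a decision problem to the instances with property `P`
(same words, same yes-instances). -/
def DecisionProblem.restrict (A : DecisionProblem) (P : A.Instance → Prop) : DecisionProblem where
  Instance := {x : A.Instance // P x}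
  encode x := A.encode x.1
  encode_injective _ _ h := Subtype.ext (A.encode_injective h)
  IsYes x := A.IsYes x.1

/-- `A` is polynomial-time (many-one) reducible to `B`: some function from the instances of `A`
to the instances of `B` that preserves and reflects yes-instances is computed by a Turing machine,
on the words that encode the instances, in a number of steps that is bounded by a polynomial in
the length of the input word. -/
def DecisionProblem.PolyTimeReducible (A B : DecisionProblem) : Prop :=
  ∃ f : A.Instance → B.Instance,
    Nonempty (Turing.TM2ComputableInPolyTime A.encode B.encode f) ∧
      ∀ x, A.IsYes x ↔ B.IsYes (f x)

/-! ## Words for natural numbers and for tables -/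

/-- A natural number in unary, with an end marker: `1 ⋯ 1 0`. -/
def unaryWord (k : ℕ) : List Bool := List.replicate k true ++ [false]

theorem unaryWord_append_inj {a b : ℕ} {x y : List Bool}
    (h : unaryWord a ++ x = unaryWord b ++ y) : a = b ∧ x = y := by
  induction a generalizing b with
  | zero =>
    cases b with
    | zero => simpa [unaryWord] using h
    | succ b => simp [unaryWord, List.replicate_succ] at h
  | succ a ih =>
    cases b with
    | zero => simp [unaryWord, List.replicate_succ] at h
    | succ b =>
      have h' : unaryWord a ++ x = unaryWord b ++ y := by
        simpa [unaryWord, List.replicate_succ] using h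
      obtain ⟨h1, h2⟩ := ih h'
      exact ⟨by rw [h1], h2⟩

/-- The word for a finite sequence of natural numbers. -/
def natsWord (l : List ℕ) : List Bool := l.flatMap unaryWord

theorem natsWord_injective : Function.Injective natsWord := by
  intro l
  induction l with
  | nil =>
    intro l' h
    cases l' with
    | nil => rfl
    | cons b t => simp [natsWord, unaryWord] at h
  | cons a s ih =>
    intro l' h
    cases l' with
    | nil => simp [natsWord, unaryWord] at h
    | cons b t =>
      have h' : unaryWord a ++ natsWord s = unaryWord b ++ natsWord t := by
        simpa [natsWord] using h
      obtain ⟨h1, h2⟩ := unaryWord_append_inj h'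
      rw [h1, ih h2]

/-- The concatenation `f 0 ++ f 1 ++ ⋯ ++ f (m - 1)`. -/
def concatFin {β : Type} {m : ℕ} (f : Fin m → List β) : List β := (List.ofFn f).flatten

theorem concatFin_length {β : Type} {m k : ℕ} {f : Fin m → List β}
    (hf : ∀ i, (f i).length = k) : (concatFin f).length = m * k := by
  induction m with
  | zero => simp [concatFin]
  | succ m ih =>
    have h := ih (f := fun i => f i.succ) (fun i => hf _)
    simp only [concatFin] at h
    simp only [concatFin, List.ofFn_succ, List.flatten_cons, List.length_append, h, hf]
    ring

theorem concatFin_inj {β : Type} {m k : ℕ} {f g : Fin m → List β}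
    (hf : ∀ i, (f i).length = k) (hg : ∀ i, (g i).length = k)
    (h : concatFin f = concatFin g) : f = g := by
  induction m with
  | zero => exact funext fun i => i.elim0
  | succ m ih =>
    simp only [concatFin, List.ofFn_succ, List.flatten_cons] at h
    obtain ⟨h0, h1⟩ := List.append_inj h (by rw [hf, hg])
    have h2 := ih (f := fun i => f i.succ) (g := fun i => g i.succ)
      (fun i => hf _) (fun i => hg _) h1
    funext i
    refine Fin.cases h0 (fun j => ?_) i
    exact congrFun h2 j

/-! ## Graph Isomorphism -/

/-- An instance of Graph Isomorphism: two undirected graphs with the same number of vertices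
and the same number of edges. -/
structure GraphPair where
  /-- the number of vertices -/
  n : ℕ
  /-- the first graph -/
  G : SimpleGraph (Fin n)
  /-- the second graph -/
  H : SimpleGraph (Fin n)
  /-- the graphs have the same number of edges -/
  card_edges : G.edgeSet.ncard = H.edgeSet.ncard

open Classical in
/-- The adjacency matrix of a graph, written row by row. -/
noncomputable def adjacencyWord {n : ℕ} (G : SimpleGraph (Fin n)) : List Bool :=
  concatFin fun u : Fin n => List.ofFn fun v : Fin n => decide (G.Adj u v)

theorem adjacencyWord_length {n : ℕ} (G : SimpleGraph (Fin n)) :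
    (adjacencyWord G).length = n * n :=
  concatFin_length fun _ => List.length_ofFn

theorem adjacencyWord_injective {n : ℕ} :
    Function.Injective (adjacencyWord : SimpleGraph (Fin n) → List Bool) := by
  intro G H h
  have h1 := concatFin_inj (k := n) (fun _ => List.length_ofFn) (fun _ => List.length_ofFn) h
  ext u v
  have h2 := congrFun (List.ofFn_injective (congrFun h1 u)) v
  simpa using h2

/-- The number of vertices in unary, followed by the two adjacency matrices. -/
noncomputable def GraphPair.encode (I : GraphPair) : List Bool :=
  unaryWord I.n ++ (adjacencyWord I.G ++ adjacencyWord I.H)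

theorem GraphPair.encode_injective : Function.Injective GraphPair.encode := by
  rintro ⟨n, G, H, hm⟩ ⟨n', G', H', hm'⟩ h
  obtain ⟨rfl, h1⟩ := unaryWord_append_inj h
  obtain ⟨h2, h3⟩ := List.append_inj h1 (by simp only [adjacencyWord_length])
  obtain rfl := adjacencyWord_injective h2
  obtain rfl := adjacencyWord_injective h3
  rfl

/-- Graph Isomorphism: is there a bijection between the vertex sets that preserves and reflects
adjacency? -/
noncomputable def graphIsomorphism : DecisionProblem where
  Instance := GraphPair
  encode := GraphPair.encode
  encode_injective := GraphPair.encode_injective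
  IsYes I := Nonempty (I.G ≃g I.H)

/-! ## Individually Stable Marriage with multi-layer preferences -/

/-- A preference list over `n` agents, i.e. a linear order given by listing the agents from the
most preferred one (position `0`) to the least preferred one (position `n - 1`). -/
abbrev PrefList (n : ℕ) : Type := Equiv.Perm (Fin n)

/-- In the preference list `p`, agent `a` is ranked (strictly) above agent `b`. -/
def PrefList.Prefers {n : ℕ} (p : PrefList n) (a b : Fin n) : Prop :=
  Equiv.symm p a < Equiv.symm p b

/-- An instance of multi-layer stable marriage. The two disjoint sets `U` and `W` of agents are
two copies of `Fin n`. -/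
structure MultiLayerMarriage where
  /-- the number of agents on each side -/
  n : ℕ
  /-- the number `ℓ` of layers -/
  layers : ℕ
  /-- the integer bound `α` -/
  alpha : ℕ
  /-- the bound `α` belongs to `{1, …, ℓ}` -/
  one_le_alpha : 1 ≤ alpha
  /-- the bound `α` belongs to `{1, …, ℓ}` -/
  alpha_le_layers : alpha ≤ layers
  /-- the preference list of agent `u ∈ U` over `W` in each layer -/
  prefU : Fin layers → Fin n → PrefList n
  /-- the preference list of agent `w ∈ W` over `U` in each layer -/
  prefW : Fin layers → Fin n → PrefList n

/-- A set of pairs `(u, w)` with `u ∈ U` and `w ∈ W` is a matching if its members are pairwise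
disjoint. Agents may stay unmatched. -/
def IsMatching {n : ℕ} (M : Set (Fin n × Fin n)) : Prop :=
  ∀ p ∈ M, ∀ q ∈ M, p ≠ q → p.1 ≠ q.1 ∧ p.2 ≠ q.2

/-- Individual stability of `M` with respect to the bound `α`: for each pair `{u, w}` outside `M`
there is a set `S` of `α` layers such that `u` has a partner whom it prefers to `w` in each layer
of `S`, or `w` has a partner whom it prefers to `u` in each layer of `S`. -/
def MultiLayerMarriage.IndividuallyStable (I : MultiLayerMarriage)
    (M : Set (Fin I.n × Fin I.n)) : Prop :=
  ∀ u w : Fin I.n, (u, w) ∉ M →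
    ∃ S : Finset (Fin I.layers), S.card = I.alpha ∧
      ((∃ w', (u, w') ∈ M ∧ ∀ i ∈ S, (I.prefU i u).Prefers w' w) ∨
        (∃ u', (u', w) ∈ M ∧ ∀ i ∈ S, (I.prefW i w).Prefers u' u))

/-- The preferences are uniform in each layer: in each layer, all agents of `U` have the same
preference list, and so do all agents of `W`. -/
def MultiLayerMarriage.Uniform (I : MultiLayerMarriage) : Prop :=
  ∀ i : Fin I.layers, (∀ u u' : Fin I.n, I.prefU i u = I.prefU i u') ∧
    (∀ w w' : Fin I.n, I.prefW i w = I.prefW i w')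

/-- The preference lists of one side in one layer, one after the other. -/
def profileNats {n : ℕ} (p : Fin n → PrefList n) : List ℕ :=
  concatFin fun a : Fin n => List.ofFn fun k : Fin n => ((p a k : Fin n) : ℕ)

theorem profileNats_length {n : ℕ} (p : Fin n → PrefList n) :
    (profileNats p).length = n * n :=
  concatFin_length fun _ => List.length_ofFn

theorem profileNats_injective {n : ℕ} :
    Function.Injective (profileNats : (Fin n → PrefList n) → List ℕ) := by
  intro p q h
  have h1 := concatFin_inj (k := n) (fun _ => List.length_ofFn) (fun _ => List.length_ofFn) h
  funext a
  ext k
  exact congrFun (List.ofFn_injective (congrFun h1 a)) k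

/-- The numbers `n`, `ℓ`, `α`, followed, layer by layer, by the preference lists of all agents of
`U` and then of all agents of `W`. Numbers are written in unary; for `n ≥ 1` the `2 n ℓ` preference
lists are listed explicitly, so this changes the length of the word only polynomially. -/
def MultiLayerMarriage.encode (I : MultiLayerMarriage) : List Bool :=
  natsWord (I.n :: I.layers :: I.alpha ::
    concatFin fun i : Fin I.layers => profileNats (I.prefU i) ++ profileNats (I.prefW i))

theorem MultiLayerMarriage.encode_injective : Function.Injective MultiLayerMarriage.encode := by
  rintro ⟨n, l, a, h1, h2, p, q⟩ ⟨n', l', a', h1', h2', p', q'⟩ h0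
  have h := natsWord_injective h0
  simp only [List.cons.injEq] at h
  obtain ⟨rfl, rfl, rfl, h⟩ := h
  clear h0
  have h3 := concatFin_inj (k := n * n + n * n)
    (fun _ => by simp only [List.length_append, profileNats_length])
    (fun _ => by simp only [List.length_append, profileNats_length]) h
  have h4 : ∀ i, p i = p' i ∧ q i = q' i := by
    intro i
    obtain ⟨h5, h6⟩ := List.append_inj (congrFun h3 i) (by simp only [profileNats_length])
    exact ⟨profileNats_injective h5, profileNats_injective h6⟩
  obtain rfl : p = p' := funext fun i => (h4 i).1
  obtain rfl : q = q' := funext fun i => (h4 i).2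
  rfl

/-- Individually Stable Marriage: is there a matching that is individually stable with respect to
the given bound? -/
def individuallyStableMarriage : DecisionProblem where
  Instance := MultiLayerMarriage
  encode := MultiLayerMarriage.encode
  encode_injective := MultiLayerMarriage.encode_injective
  IsYes I := ∃ M : Set (Fin I.n × Fin I.n), IsMatching M ∧ I.IndividuallyStable M

/-! Preferences realise digraphs, in the manner of McGarvey. Let a digraph without opposite arcs be
given on `N` agents. For each agent `a` there are two lists: `a`, its out-neighbours, the others;
and the others, `a`, its out-neighbours, with the order inside each part reversed. Two agents are
ranked oppositely by these lists, except that `a` precedes its out-neighbours in both. Hence among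
all `2N` layers, `b` beats `c` in `N + 1`, `N` or `N - 1` of them, according as there is an arc from
`b` to `c`, no arc, or an arc from `c` to `b`. So `N` layers in favour of `b` exist iff there is no
arc from `c` to `b` (`exists_layers_prefer_iff`).

Put one such digraph on `U` and one on `W`. A stable matching is perfect, so it is a bijection `f`,
and the pair of `a` and `f b` is harmless unless `a → b` and `f b → f a` are both arcs. Stability
thus says that `f` never reverses an arc (`exists_stable_iff`).

A graph becomes a digraph on gates, vertices and ordered pairs of vertices (`gadgetArc`), with all
arcs from vertices to gates and from gates to pairs. Gates are so numerous that some gate goes to a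
gate; then a bijection that reverses no arc preserves the three kinds. Between vertices and pairs
exactly one direction is present, so there "not reversed" means "preserved". A pair has two
in-neighbours only if it is an edge, and these are its ends; therefore edges go to edges. The
inverse bijection has the same property, whence an isomorphism (`exists_equiv_gadgetArc_iff`).

For the running time, the output word is described in a small language of nested loops bounded by
registers, with tests on the input matrices. Its programs compile to stack programs and these to
machines; a polynomial bound follows by structural induction (`Generator.does_program`,
`Generator.nonempty_computable`), and `word_instanceWord` identifies the word written. -/

open Turing

/-! ## Structured stack programs and their compilation to Turing machines -/

/-- Structured programs over stacks of bits indexed by `K`, with one register that holds the bit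
read last (`none` if the stack was empty). -/
inductive StackProgram (K : Type) : Type
  | skip : StackProgram K
  | pop (k : K) : StackProgram K
  | push (k : K) (f : Option Bool → Bool) : StackProgram K
  | seq (p q : StackProgram K) : StackProgram K
  | ite (c : Option Bool → Bool) (p q : StackProgram K) : StackProgram K
  | loop (c : Option Bool → Bool) (p : StackProgram K) : StackProgram K

namespace StackProgram

variable {K : Type}

/-- The labels of the machine code of a program. -/
def Label : StackProgram K → Type
  | skip => Unit
  | pop _ => Unit
  | push _ _ => Unit
  | seq p q => p.Label ⊕ q.Label
  | ite _ p q => Option (p.Label ⊕ q.Label)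
  | loop _ p => Option p.Label

/-- A program has finitely many labels. -/
@[reducible]
def labelFintype : (p : StackProgram K) → Fintype p.Label
  | skip => inferInstanceAs (Fintype Unit)
  | pop _ => inferInstanceAs (Fintype Unit)
  | push _ _ => inferInstanceAs (Fintype Unit)
  | seq p q =>
    letI := p.labelFintype
    letI := q.labelFintype
    inferInstanceAs (Fintype (p.Label ⊕ q.Label))
  | ite _ p q =>
    letI := p.labelFintype
    letI := q.labelFintype
    inferInstanceAs (Fintype (Option (p.Label ⊕ q.Label)))
  | loop _ p =>
    letI := p.labelFintype
    inferInstanceAs (Fintype (Option p.Label))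

/-- The label at which the execution of a program starts. -/
def entry : (p : StackProgram K) → p.Label
  | skip => ()
  | pop _ => ()
  | push _ _ => ()
  | seq p _ => Sum.inl p.entry
  | ite _ _ _ => none
  | loop _ _ => none

/-- The machine code of a program, placed into a machine along `emb`, that continues at `exit`. -/
def code : (p : StackProgram K) → {Λ : Type} → (p.Label → Λ) → Λ → p.Label →
    TM2.Stmt (fun _ : K => Bool) Λ (Option Bool)
  | skip, _, _, exit, _ => .goto fun _ => exit
  | pop k, _, _, exit, _ => .pop k (fun _ b => b) (.goto fun _ => exit)
  | push k f, _, _, exit, _ => .push k f (.goto fun _ => exit)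
  | seq p q, _, emb, exit, l =>
    match l with
    | Sum.inl l => p.code (fun l => emb (Sum.inl l)) (emb (Sum.inr q.entry)) l
    | Sum.inr l => q.code (fun l => emb (Sum.inr l)) exit l
  | ite c p q, _, emb, exit, l =>
    match l with
    | none => .branch c (.goto fun _ => emb (some (Sum.inl p.entry)))
        (.goto fun _ => emb (some (Sum.inr q.entry)))
    | some (Sum.inl l) => p.code (fun l => emb (some (Sum.inl l))) exit l
    | some (Sum.inr l) => q.code (fun l => emb (some (Sum.inr l))) exit l
  | loop c p, _, emb, exit, l =>
    match l with
    | none => .branch c (.goto fun _ => emb (some p.entry)) (.goto fun _ => exit)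
    | some l => p.code (fun l => emb (some l)) (emb none) l

variable [DecidableEq K]

/-- The machine `M` gets from `c` to `c'` in at most `t` steps. -/
def StepsWithin {Λ : Type} (M : Λ → TM2.Stmt (fun _ : K => Bool) Λ (Option Bool))
    (c c' : TM2.Cfg (fun _ : K => Bool) Λ (Option Bool)) (t : ℕ) : Prop :=
  ∃ t' ≤ t, (flip bind (TM2.step M))^[t'] (some c) = some c'

theorem StepsWithin.trans {Λ : Type} {M : Λ → TM2.Stmt (fun _ : K => Bool) Λ (Option Bool)}
    {a b c : TM2.Cfg (fun _ : K => Bool) Λ (Option Bool)} {t₁ t₂ : ℕ}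
    (h₁ : StepsWithin M a b t₁) (h₂ : StepsWithin M b c t₂) : StepsWithin M a c (t₁ + t₂) := by
  obtain ⟨u₁, hu₁, e₁⟩ := h₁
  obtain ⟨u₂, hu₂, e₂⟩ := h₂
  refine ⟨u₂ + u₁, by omega, ?_⟩
  rw [Function.iterate_add_apply, e₁, e₂]

theorem StepsWithin.mono {Λ : Type} {M : Λ → TM2.Stmt (fun _ : K => Bool) Λ (Option Bool)}
    {a b : TM2.Cfg (fun _ : K => Bool) Λ (Option Bool)} {t₁ t₂ : ℕ}
    (h : StepsWithin M a b t₁) (ht : t₁ ≤ t₂) : StepsWithin M a b t₂ := by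
  obtain ⟨u, hu, e⟩ := h
  exact ⟨u, hu.trans ht, e⟩

theorem StepsWithin.single {Λ : Type} {M : Λ → TM2.Stmt (fun _ : K => Bool) Λ (Option Bool)}
    {l : Λ} {v : Option Bool} {s : K → List Bool}
    {b : TM2.Cfg (fun _ : K => Bool) Λ (Option Bool)}
    (h : TM2.stepAux (M l) v s = b) : StepsWithin M ⟨some l, v, s⟩ b 1 :=
  ⟨1, le_rfl, by simp [flip, ← h]⟩

/-- Started with register `v` and stacks `s`, the program `p` ends with register `v'` and
stacks `s'` after at most `t` steps, in every machine that contains its code. -/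
def Runs (p : StackProgram K) (v : Option Bool) (s : K → List Bool) (v' : Option Bool)
    (s' : K → List Bool) (t : ℕ) : Prop :=
  ∀ (Λ : Type) (M : Λ → TM2.Stmt (fun _ : K => Bool) Λ (Option Bool)) (emb : p.Label → Λ)
    (exit : Λ), (∀ l, M (emb l) = p.code emb exit l) →
      StepsWithin M ⟨some (emb p.entry), v, s⟩ ⟨some exit, v', s'⟩ t

variable {p q : StackProgram K} {c : Option Bool → Bool} {v v₁ v₂ : Option Bool}
  {s s₁ s₂ : K → List Bool} {t t₁ t₂ : ℕ}

theorem Runs.mono (h : p.Runs v s v₁ s₁ t₁) (ht : t₁ ≤ t₂) : p.Runs v s v₁ s₁ t₂ :=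
  fun Λ M emb exit hM => (h Λ M emb exit hM).mono ht

theorem runs_skip : (skip : StackProgram K).Runs v s v s 1 := fun Λ M emb exit hM =>
  .single (by rw [hM]; rfl)

theorem runs_pop (k : K) :
    (pop k).Runs v s (s k).head? (Function.update s k (s k).tail) 1 := fun Λ M emb exit hM =>
  .single (by rw [hM]; rfl)

theorem runs_push (k : K) (f : Option Bool → Bool) :
    (push k f).Runs v s v (Function.update s k (f v :: s k)) 1 := fun Λ M emb exit hM =>
  .single (by rw [hM]; rfl)

/-- Since `Runs` quantifies over all host machines and all placements of the labels, the parts of a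
composite program run inside the same machine, and their runs concatenate. -/
theorem Runs.seq (h₁ : p.Runs v s v₁ s₁ t₁) (h₂ : q.Runs v₁ s₁ v₂ s₂ t₂) :
    (p.seq q).Runs v s v₂ s₂ (t₁ + t₂) := fun Λ M emb exit hM =>
  (h₁ Λ M (fun l => emb (Sum.inl l)) (emb (Sum.inr q.entry)) fun l => hM (Sum.inl l)).trans
    (h₂ Λ M (fun l => emb (Sum.inr l)) exit fun l => hM (Sum.inr l))

theorem Runs.ite_true (hc : c v = true) (h : p.Runs v s v₁ s₁ t) :
    (ite c p q).Runs v s v₁ s₁ (1 + t) := fun Λ M emb exit hM =>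
  (StepsWithin.single (by rw [hM]; simp [entry, code, hc])).trans
    (h Λ M (fun l => emb (some (Sum.inl l))) exit fun l => hM (some (Sum.inl l)))

theorem Runs.ite_false (hc : c v = false) (h : q.Runs v s v₁ s₁ t) :
    (ite c p q).Runs v s v₁ s₁ (1 + t) := fun Λ M emb exit hM =>
  (StepsWithin.single (by rw [hM]; simp [entry, code, hc])).trans
    (h Λ M (fun l => emb (some (Sum.inr l))) exit fun l => hM (some (Sum.inr l)))

theorem runs_loop_false (hc : c v = false) : (loop c p).Runs v s v s 1 := fun Λ M emb exit hM =>
  .single (by rw [hM]; simp [entry, code, hc])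

/-- The body exits to the label `none` of the loop, where the condition is tested again; the leading
`1` pays for one test. -/
theorem Runs.loop_true (hc : c v = true) (h₁ : p.Runs v s v₁ s₁ t₁)
    (h₂ : (loop c p).Runs v₁ s₁ v₂ s₂ t₂) :
    (loop c p).Runs v s v₂ s₂ (1 + t₁ + t₂) := fun Λ M emb exit hM =>
  ((StepsWithin.single (by rw [hM]; simp [entry, code, hc])).trans
    (h₁ Λ M (fun l => emb (some l)) (emb none) fun l => hM (some l))).trans (h₂ Λ M emb exit hM)

/-- The program `p` turns the stacks `s` into `s'` in at most `t` steps, whatever the register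
holds. -/
def Does (p : StackProgram K) (s s' : K → List Bool) (t : ℕ) : Prop :=
  ∀ v, ∃ v', p.Runs v s v' s' t

theorem Does.mono (h : p.Does s s₁ t₁) (ht : t₁ ≤ t₂) : p.Does s s₁ t₂ := fun v =>
  (h v).imp fun _ h => h.mono ht

theorem Does.of_eq (h : p.Does s s₁ t) (e : s₁ = s₂) : p.Does s s₂ t := e ▸ h

theorem Does.seq (h₁ : p.Does s s₁ t₁) (h₂ : q.Does s₁ s₂ t₂) :
    (p.seq q).Does s s₂ (t₁ + t₂) := fun v => by
  obtain ⟨v₁, h₁⟩ := h₁ v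
  obtain ⟨v₂, h₂⟩ := h₂ v₁
  exact ⟨v₂, h₁.seq h₂⟩

theorem does_skip : (skip : StackProgram K).Does s s 1 := fun v => ⟨v, runs_skip⟩

theorem does_push (k : K) (b : Bool) :
    (push k fun _ => b).Does s (Function.update s k (b :: s k)) 1 := fun v => ⟨v, runs_push k _⟩

/-- Pop a stack and branch on the bit read. -/
def popIte (k : K) (c : Option Bool → Bool) (p q : StackProgram K) : StackProgram K :=
  (pop k).seq (ite c p q)

theorem does_popIte_true {k : K} (hc : c (s k).head? = true)
    (h : p.Does (Function.update s k (s k).tail) s₁ t) : (popIte k c p q).Does s s₁ (2 + t) := by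
  intro v
  obtain ⟨v₁, h⟩ := h (s k).head?
  exact ⟨v₁, ((runs_pop k).seq (h.ite_true hc)).mono (by omega)⟩

theorem does_popIte_false {k : K} (hc : c (s k).head? = false)
    (h : q.Does (Function.update s k (s k).tail) s₁ t) : (popIte k c p q).Does s s₁ (2 + t) := by
  intro v
  obtain ⟨v₁, h⟩ := h (s k).head?
  exact ⟨v₁, ((runs_pop k).seq (h.ite_false hc)).mono (by omega)⟩

/-- Pop a stack and run `p`, as long as the bit read satisfies `c`. -/
def popLoop (k : K) (c : Option Bool → Bool) (p : StackProgram K) : StackProgram K :=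
  (pop k).seq (loop c (p.seq (pop k)))

/-- The iterations of a loop are numbered downwards; `A j` are the stacks when `j` iterations
are left. -/
theorem runs_popLoop {k : K} (A : ℕ → K → List Bool) (b : ℕ)
    (h₀ : c (A 0 k).head? = false)
    (h : ∀ j < b, c (A (j + 1) k).head? = true ∧
      ∃ v, p.Runs (A (j + 1) k).head? (Function.update (A (j + 1)) k (A (j + 1) k).tail) v (A j) t) :
    (popLoop k c p).Runs v (A b) (A 0 k).head? (Function.update (A 0) k (A 0 k).tail)
      (b * (t + 2) + 2) := by
  -- The invariant holds at the loop test, just after a pop: the top of stack `k` has moved to the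
  -- register. Each round costs a test, the body and a pop, hence `t + 2`.
  have key : ∀ b' ≤ b, (loop c (p.seq (pop k))).Runs (A b' k).head?
      (Function.update (A b') k (A b' k).tail) (A 0 k).head?
      (Function.update (A 0) k (A 0 k).tail) (b' * (t + 2) + 1) := by
    intro b'
    induction b' with
    | zero => exact fun _ => (runs_loop_false h₀).mono (by omega)
    | succ j ih =>
      intro hj
      obtain ⟨hc, v', hp⟩ := h j (by omega)
      refine ((hp.seq (runs_pop k)).loop_true hc (ih (by omega))).mono (le_of_eq (by ring))
  exact ((runs_pop k).seq (key b le_rfl)).mono (by omega)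

theorem does_popLoop {k : K} (A : ℕ → K → List Bool) (b : ℕ)
    (h₀ : c (A 0 k).head? = false)
    (h : ∀ j < b, c (A (j + 1) k).head? = true ∧
      p.Does (Function.update (A (j + 1)) k (A (j + 1) k).tail) (A j) t) :
    (popLoop k c p).Does (A b) (Function.update (A 0) k (A 0 k).tail) (b * (t + 2) + 2) := fun _ =>
  ⟨_, runs_popLoop A b h₀ fun j hj => ⟨(h j hj).1, (h j hj).2 _⟩⟩

/-- The machine that runs a program, with input stack `i` and output stack `o`. -/
def machine [Fintype K] (p : StackProgram K) (i o : K) : FinTM2 :=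
  letI := p.labelFintype
  { K := K
    k₀ := i
    k₁ := o
    Γ := fun _ => Bool
    Λ := Option p.Label
    main := some p.entry
    σ := Option Bool
    initialState := none
    Γk₀Fin := inferInstanceAs (Fintype Bool)
    m := fun l => l.elim .halt (p.code some none) }

/-- A program that computes `f` on words within polynomial time is a witness of polynomial-time
computability. -/
theorem Runs.nonempty_computable [Fintype K] {α β : Type} {ea : α → List Bool}
    {eb : β → List Bool} {f : α → β} (p : StackProgram K) (i o : K) (T : Polynomial ℕ)
    (h : ∀ a, p.Runs none (Function.update (fun _ => []) i (ea a)) none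
      (Function.update (fun _ => []) o (eb (f a))) (T.eval (ea a).length)) :
    Nonempty (TM2ComputableInPolyTime ea eb f) := by
  have key : ∀ a, Nonempty (TM2OutputsInTime (p.machine i o) (ea a) (some (eb (f a)))
      ((T + 1).eval (ea a).length)) := by
    intro a
    have h1 := h a _ (p.machine i o).m some none fun l => rfl
    -- The label `none` carries `halt`; executing it is the additional step in `T + 1`.
    have h2 := h1.trans (StepsWithin.single (M := (p.machine i o).m) (l := none) rfl)
    obtain ⟨t, ht, e⟩ := h2
    refine ⟨⟨⟨t, ?_⟩, by simpa using ht⟩⟩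
    have e1 : initList (p.machine i o) (ea a)
        = ⟨some (some p.entry), none, Function.update (fun _ => []) i (ea a)⟩ := by
      unfold initList
      congr 1
      funext (k : K)
      by_cases hk : k = i
      · obtain rfl := hk.symm
        exact (dif_pos rfl).trans
          (Function.update_self (β := fun _ : K => List Bool) i (ea a) fun _ => []).symm
      · exact (dif_neg hk).trans
          (Function.update_of_ne (β := fun _ : K => List Bool) hk (ea a) fun _ => []).symm
    have e2 : haltList (p.machine i o) (eb (f a))
        = ⟨none, none, Function.update (fun _ => []) o (eb (f a))⟩ := by
      unfold haltList
      congr 1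
      funext (k : K)
      by_cases hk : k = o
      · obtain rfl := hk.symm
        exact (dif_pos rfl).trans
          (Function.update_self (β := fun _ : K => List Bool) o (eb (f a)) fun _ => []).symm
      · exact (dif_neg hk).trans
          (Function.update_of_ne (β := fun _ : K => List Bool) hk (eb (f a)) fun _ => []).symm
    rw [e1]
    exact e.trans (congrArg some e2.symm)
  exact ⟨{ tm := p.machine i o
           inputAlphabet := Equiv.refl Bool
           outputAlphabet := Equiv.refl Bool
           time := T + 1
           outputsFun := fun a => by
             have h := (key a).some
             have e (l : List Bool) : l.map (Equiv.refl Bool).invFun = l := List.map_id l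
             exact cast (congrArg₂ (fun x y => TM2OutputsInTime (p.machine i o) x (some y)
               ((T + 1).eval (ea a).length)) (e (ea a)) (e (eb (f a)))).symm h }⟩

end StackProgram

/-! ## Memories: registers in unary, an input word with a head, an output word -/

/-- The registers; registers `18, …, 21` are reserved for the evaluation of tests. -/
abbrev Register : Type := Fin 22

/-- The stacks that store a memory. -/
inductive MemoryStack : Type
  | input : MemoryStack
  | output : MemoryStack
  | tape : MemoryStack
  | tmp : MemoryStack
  | flag : MemoryStack
  | reg (x : Register) : MemoryStack
  deriving DecidableEq, Fintype

/-- The input word is split at the position of the head into `tape` (reversed) and `input`. -/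
structure Memory : Type where
  input : List Bool
  output : List Bool
  tape : List Bool
  tmp : ℕ
  flag : ℕ
  reg : Register → ℕ

namespace Memory

/-- Replace the contents of the registers. -/
def withReg (m : Memory) (ρ : Register → ℕ) : Memory := { m with reg := ρ }

/-- The contents of the stacks; numbers are stored in unary. -/
def contents (m : Memory) : MemoryStack → List Bool
  | .input => m.input
  | .output => m.output
  | .tape => m.tape
  | .tmp => List.replicate m.tmp true
  | .flag => List.replicate m.flag true
  | .reg x => List.replicate (m.reg x) true

theorem update_input (m : Memory) (l : List Bool) :
    Function.update m.contents .input l = contents { m with input := l } := by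
  funext k
  cases k <;> rfl

theorem update_output (m : Memory) (l : List Bool) :
    Function.update m.contents .output l = contents { m with output := l } := by
  funext k
  cases k <;> rfl

theorem update_tape (m : Memory) (l : List Bool) :
    Function.update m.contents .tape l = contents { m with tape := l } := by
  funext k
  cases k <;> rfl

theorem update_tmp (m : Memory) (a : ℕ) :
    Function.update m.contents .tmp (List.replicate a true) = contents { m with tmp := a } := by
  funext k
  cases k <;> rfl

theorem update_flag (m : Memory) (a : ℕ) :
    Function.update m.contents .flag (List.replicate a true) = contents { m with flag := a } := by
  funext k
  cases k <;> rfl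

theorem update_reg (m : Memory) (x : Register) (a : ℕ) :
    Function.update m.contents (.reg x) (List.replicate a true)
      = (m.withReg (Function.update m.reg x a)).contents := by
  funext k
  cases k with
  | reg y =>
    by_cases h : y = x
    · subst h
      simp [contents, withReg]
    · simp [contents, withReg, Function.update, h]
  | _ => rfl

end Memory

/-! ### Unary arithmetic and bounded loops on registers -/

namespace StackProgram

open Function Memory

theorem does_push_output (m : Memory) (b : Bool) :
    (push MemoryStack.output fun _ => b).Does m.contents
      (contents { m with output := b :: m.output }) 1 := by
  have h := does_push (s := m.contents) MemoryStack.output b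
  rw [update_output] at h
  exact h

theorem does_push_tmp (m : Memory) :
    (push MemoryStack.tmp fun _ => true).Does m.contents (contents { m with tmp := m.tmp + 1 }) 1 := by
  have h := does_push (s := m.contents) MemoryStack.tmp true
  have e := update_tmp m (m.tmp + 1)
  exact h.of_eq e

theorem does_push_flag (m : Memory) :
    (push MemoryStack.flag fun _ => true).Does m.contents
      (contents { m with flag := m.flag + 1 }) 1 := by
  have h := does_push (s := m.contents) MemoryStack.flag true
  have e := update_flag m (m.flag + 1)
  exact h.of_eq e

theorem does_push_reg (m : Memory) (x : Register) :
    (push (MemoryStack.reg x) fun _ => true).Does m.contents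
      (m.withReg (update m.reg x (m.reg x + 1))).contents 1 := by
  have h := does_push (s := m.contents) (MemoryStack.reg x) true
  have e := update_reg m x (m.reg x + 1)
  exact h.of_eq e

/-- A loop that counts down a number in unary; `A j` are the stacks when `j` iterations are
left. -/
theorem does_countdown {K : Type} [DecidableEq K] {p : StackProgram K} {t : ℕ} (k : K)
    (A : ℕ → K → List Bool) (b : ℕ) (hA : ∀ j ≤ b, A j k = List.replicate j true)
    (h : ∀ j < b, p.Does (update (A (j + 1)) k (List.replicate j true)) (A j) t) :
    (popLoop k Option.isSome p).Does (A b) (A 0) (b * (t + 2) + 2) := by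
  have e := hA 0 (Nat.zero_le b)
  have h1 := does_popLoop (c := Option.isSome) (k := k) (p := p) (t := t) A b (by simp [e])
    fun j hj => by
      rw [hA (j + 1) (by omega)]
      exact ⟨rfl, h j hj⟩
  -- The pop that ends the loop meets an empty stack and changes nothing.
  have h2 : update (A 0) k (A 0 k).tail = A 0 := by
    rw [e]
    exact (congrArg (update (A 0) k) e.symm).trans (update_eq_self k (A 0))
  rwa [h2] at h1

theorem does_countdown_reg {p : StackProgram MemoryStack} {t : ℕ} (x : Register) (A : ℕ → Memory)
    (b : ℕ) (hA : ∀ j ≤ b, (A j).reg x = j)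
    (h : ∀ j < b, p.Does ((A (j + 1)).withReg (update (A (j + 1)).reg x j)).contents
      (A j).contents t) :
    (popLoop (.reg x) Option.isSome p).Does (A b).contents (A 0).contents (b * (t + 2) + 2) :=
  does_countdown _ (fun j => (A j).contents) b (fun j hj => by simp only [contents, hA j hj])
    fun j hj => by
      simp only [update_reg]
      exact h j hj

theorem does_countdown_tmp {p : StackProgram MemoryStack} {t : ℕ} (A : ℕ → Memory)
    (b : ℕ) (hA : ∀ j ≤ b, (A j).tmp = j)
    (h : ∀ j < b, p.Does (contents { A (j + 1) with tmp := j }) (A j).contents t) :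
    (popLoop .tmp Option.isSome p).Does (A b).contents (A 0).contents (b * (t + 2) + 2) :=
  does_countdown _ (fun j => (A j).contents) b (fun j hj => by simp only [contents, hA j hj])
    fun j hj => by
      simp only [update_tmp]
      exact h j hj

theorem does_countdown_flag {p : StackProgram MemoryStack} {t : ℕ} (A : ℕ → Memory)
    (b : ℕ) (hA : ∀ j ≤ b, (A j).flag = j)
    (h : ∀ j < b, p.Does (contents { A (j + 1) with flag := j }) (A j).contents t) :
    (popLoop .flag Option.isSome p).Does (A b).contents (A 0).contents (b * (t + 2) + 2) :=
  does_countdown _ (fun j => (A j).contents) b (fun j hj => by simp only [contents, hA j hj])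
    fun j hj => by
      simp only [update_flag]
      exact h j hj

/-- Set a register to zero. -/
def clear (x : Register) : StackProgram MemoryStack := popLoop (.reg x) Option.isSome skip

theorem does_clear (m : Memory) (x : Register) :
    (clear x).Does m.contents (m.withReg (update m.reg x 0)).contents (m.reg x * 3 + 2) := by
  have h := does_countdown_reg (p := skip) (t := 1) x
    (fun j => m.withReg (update m.reg x j)) (m.reg x) (fun j _ => by simp [withReg])
    fun j _ => by
      simp only [withReg, update_idem]
      exact does_skip
  simp only [update_eq_self] at h
  exact h

/-- Add register `y` to register `x`. -/
def addTo (x y : Register) : StackProgram MemoryStack :=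
  (popLoop (.reg y) Option.isSome (push .tmp fun _ => true)).seq
    (popLoop .tmp Option.isSome
      ((push (.reg y) fun _ => true).seq (push (.reg x) fun _ => true)))

/-- Reading a unary number destroys it, so `y` is poured into `tmp` and then back into both `y` and
`x`. The two passes cost 3 and 4 steps per unit. -/
theorem does_addTo (m : Memory) (hm : m.tmp = 0) {x y : Register} (h : x ≠ y) :
    (addTo x y).Does m.contents (m.withReg (update m.reg x (m.reg x + m.reg y))).contents
      (m.reg y * 7 + 4) := by
  have h1 := does_countdown_reg (p := push .tmp fun _ => true) (t := 1) y
    (fun j => { m with tmp := m.reg y - j, reg := update m.reg y j }) (m.reg y)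
    (fun j _ => by simp)
    fun j hj => by
      have := does_push_tmp { m with tmp := m.reg y - (j + 1), reg := update m.reg y j }
      simp only [withReg, update_idem]
      rwa [show m.reg y - (j + 1) + 1 = m.reg y - j by omega] at this
  have h2 := does_countdown_tmp
    (p := (push (.reg y) fun _ => true).seq (push (.reg x) fun _ => true)) (t := 1 + 1)
    (fun j => { m with
      tmp := j
      reg := update (update m.reg y (m.reg y - j)) x (m.reg x + (m.reg y - j)) }) (m.reg y)
    (fun j _ => rfl)
    fun j hj => by
      refine Does.seq (does_push_reg _ y) ?_
      refine (does_push_reg _ x).of_eq (congrArg contents ?_)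
      simp only [withReg]
      congr 1
      funext k
      by_cases hx : k = x
      · subst hx
        simp [update, h]
        omega
      · by_cases hy : k = y
        · subst hy
          simp [update, hx]
          omega
        · simp [update, hx, hy]
  simp only [tsub_self, update_eq_self, tsub_zero, add_zero] at h1 h2
  have e : m = { m with tmp := 0 } := by rw [← hm]
  have e' : ({ m with tmp := 0, reg := update m.reg x (m.reg x + m.reg y) } : Memory)
      = m.withReg (update m.reg x (m.reg x + m.reg y)) := by rw [← hm]; rfl
  rw [← e] at h1
  have e'' : update (update m.reg y 0) x (m.reg x) = update m.reg y 0 := by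
    conv_lhs => rw [← update_of_ne h 0 m.reg, update_eq_self]
  rw [e', e''] at h2
  have h12 := h1.seq h2
  exact h12.mono (by omega)

/-- Run `p` for all values of `x` below register `y`, downwards, with the complementary value
in `x'`. -/
def forRange (x x' y : Register) (p : StackProgram MemoryStack) : StackProgram MemoryStack :=
  (addTo x y).seq
    ((popLoop (.reg x) Option.isSome (p.seq (push (.reg x') fun _ => true))).seq (clear x'))

/-- The loop consumes a copy of `y` in `x` while `x'` grows, so that `x + x' = ρ y - 1` throughout
the body. Both counters start at zero and are zero again at the end, which restores `ρ`. Copying,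
looping and clearing add `7 + 3 + 3 = 13` steps per round. -/
theorem does_forRange {p : StackProgram MemoryStack} {t : ℕ} {x x' y : Register} (hx : x ≠ x')
    (hy : x ≠ y) (ρ : Register → ℕ) (h0 : ρ x = 0) (h0' : ρ x' = 0) (A : ℕ → Memory)
    (hA : (A (ρ y)).tmp = 0)
    (h : ∀ j < ρ y, p.Does
      ((A (j + 1)).withReg (update (update ρ x j) x' (ρ y - 1 - j))).contents
      ((A j).withReg (update (update ρ x j) x' (ρ y - 1 - j))).contents t) :
    (forRange x x' y p).Does ((A (ρ y)).withReg ρ).contents ((A 0).withReg ρ).contents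
      (ρ y * (t + 13) + 8) := by
  have h1 := does_addTo ((A (ρ y)).withReg ρ) hA hy
  have h2 := does_countdown_reg (p := p.seq (push (.reg x') fun _ => true)) (t := t + 1) x
    (fun j => (A j).withReg (update (update ρ x j) x' (ρ y - j))) (ρ y)
    (fun j _ => by simp [withReg, hx])
    fun j hj => by
      have e : update (update (update ρ x (j + 1)) x' (ρ y - (j + 1))) x j
          = update (update ρ x j) x' (ρ y - 1 - j) := by
        rw [update_comm hx.symm, update_idem, show ρ y - (j + 1) = ρ y - 1 - j by omega]
      simp only [withReg, e]
      refine (h j hj).seq ?_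
      refine (does_push_reg _ x').of_eq (congrArg contents ?_)
      simp only [withReg, update_idem, update_self]
      rw [show ρ y - 1 - j + 1 = ρ y - j by omega]
  have h3 := does_clear ((A 0).withReg (update (update ρ x 0) x' (ρ y - 0))) x'
  have e1 : update (update ρ x (ρ y)) x' 0 = update ρ x (ρ y) := by
    conv_rhs => rw [← update_eq_self x' (update ρ x (ρ y))]
    rw [update_of_ne hx.symm, h0']
  have e2 : update (update ρ x 0) x' 0 = ρ := by
    funext k
    by_cases hk : k = x'
    · subst hk; simp [h0']
    · by_cases hk' : k = x
      · subst hk'; simp [hk, h0]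
      · simp [hk, hk']
  simp only [withReg, h0, zero_add] at h1
  simp only [tsub_self, e1] at h2
  simp only [withReg, update_idem, e2, update_self] at h3
  refine ((h1.seq (h2.seq h3))).mono (le_of_eq ?_)
  simp only [Nat.sub_zero]
  ring

end StackProgram

/-! ### Branching on the top of a stack -/

namespace StackProgram

open Function Memory

theorem does_popIte_isSome {K : Type} [DecidableEq K] {p q : StackProgram K} {k : K}
    {s s₁ : K → List Bool} {t a : ℕ} (hs : s k = List.replicate a true)
    (hq : a = 0 → q.Does s s₁ t)
    (hp : ∀ a', a = a' + 1 → p.Does (update s k (List.replicate a' true)) s₁ t) :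
    (popIte k Option.isSome p q).Does s s₁ (2 + t) := by
  cases a with
  | zero =>
    refine does_popIte_false (by simp [hs]) ?_
    have e : update s k (s k).tail = s := by
      conv_rhs => rw [← update_eq_self k s]
      rw [hs]
      rfl
    rw [e]
    exact hq rfl
  | succ a =>
    refine does_popIte_true (by simp [hs, List.replicate_succ]) ?_
    rw [hs]
    exact hp a rfl

theorem does_popIte_cons {K : Type} [DecidableEq K] {p q : StackProgram K} {k : K}
    {s s₁ : K → List Bool} {t : ℕ} {b : Bool} {l : List Bool} {v : Option Bool}
    (hs : s k = b :: l) (h : p.Runs (some b) (update s k l) v s₁ t) :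
    (popIte k Option.isSome p q).Does s s₁ (2 + t) := by
  intro v₀
  have h1 := runs_pop (v := v₀) (s := s) k
  rw [hs] at h1
  exact ⟨v, (h1.seq (h.ite_true (c := Option.isSome) (q := q) rfl)).mono (by omega)⟩

theorem does_popIte_nil {K : Type} [DecidableEq K] {p q : StackProgram K} {k : K}
    {s s₁ : K → List Bool} {t : ℕ} (hs : s k = []) (h : q.Does s s₁ t) :
    (popIte k Option.isSome p q).Does s s₁ (2 + t) :=
  does_popIte_isSome (a := 0) hs (fun _ => h) fun _ h => by omega

end StackProgram

namespace Memory

/-- Place the head on position `k` of the input word `w`. -/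
def headAt (m : Memory) (w : List Bool) (k : ℕ) : Memory :=
  { m with input := w.drop k, tape := (w.take k).reverse }

end Memory

/-! ## Tests -/

/-- The tests that a generator can make: equality of two registers; the bit in row `x` and
column `y` of the first or the second of two square matrices, the size of which is in
register `0`. -/
inductive Test : Type
  | eq (x y : Register) : Test
  | bit (second : Bool) (x y : Register) : Test

namespace Test

/-- The outcome of a test. -/
def eval (w : List Bool) (ρ : Register → ℕ) : Test → Bool
  | eq x y => decide (ρ x = ρ y)
  | bit h x y => w.getD ((if h then ρ 0 * ρ 0 else 0) + ρ x * ρ 0 + ρ y) false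

/-- A test uses only registers that are not reserved. -/
def Valid : Test → Prop
  | eq x y => x.val < 18 ∧ y.val < 18
  | bit _ x y => x.val < 18 ∧ y.val < 18

open StackProgram

/-- Move the head by one position. -/
def moveHead : StackProgram MemoryStack :=
  popIte .input Option.isSome (push .tape fun v => v.getD false) skip

/-- Read the bit under the head into the flag. -/
def readBit : StackProgram MemoryStack :=
  popIte .input Option.isSome
    ((push .input fun v => v.getD false).seq
      (ite (fun v => v.getD false) (push .flag fun _ => true) skip)) skip

/-- Move the head to the beginning. -/
def rewind : StackProgram MemoryStack :=
  popLoop .tape Option.isSome (push .input fun v => v.getD false)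

/-- Move the head by the product of two registers. -/
def moveHeadMul (x y : Register) : StackProgram MemoryStack :=
  forRange 18 19 x (forRange 20 21 y moveHead)

/-- Set the flag if the test succeeds. -/
def program : Test → StackProgram MemoryStack
  | eq x y => (addTo 18 x).seq ((addTo 20 y).seq
      ((popLoop (.reg 18) Option.isSome
        (popIte (.reg 20) Option.isSome skip (push .flag fun _ => true))).seq
      ((popLoop (.reg 20) Option.isSome (push .flag fun _ => true)).seq
        (popIte .flag Option.isSome (popLoop .flag Option.isSome skip)
          (push .flag fun _ => true)))))
  | bit h x y => (if h then moveHeadMul 0 0 else skip).seq ((moveHeadMul x 0).seq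
      ((forRange 18 19 y moveHead).seq (readBit.seq rewind)))

open Function Memory

/-- All positions beyond the end are the same memory, so the head may be moved by any amount without
a bounds check. -/
theorem headAt_of_length_le (m : Memory) (w : List Bool) {k : ℕ} (hk : w.length ≤ k) :
    m.headAt w k = m.headAt w w.length := by
  simp only [headAt, List.drop_of_length_le hk, List.take_of_length_le hk, List.drop_length,
    List.take_length]

theorem does_moveHead (m : Memory) (w : List Bool) (k : ℕ) :
    moveHead.Does (m.headAt w k).contents (m.headAt w (k + 1)).contents 3 := by
  by_cases hk : k < w.length
  · have hw : w.drop k = w[k] :: w.drop (k + 1) := List.drop_eq_getElem_cons hk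
    refine does_popIte_cons (s := (m.headAt w k).contents) (k := MemoryStack.input) hw (v := some w[k])
      (t := 1) ?_
    have h := runs_push (v := some w[k])
      (s := update (m.headAt w k).contents .input (w.drop (k + 1))) MemoryStack.tape
      (fun v => v.getD false)
    rw [update_input, update_tape] at h
    simp only [headAt, List.take_succ_eq_append_getElem hk, List.reverse_append] at h ⊢
    rw [update_input]
    exact h
  · rw [headAt_of_length_le m w (Nat.le_of_not_lt hk),
      headAt_of_length_le m w (k := k + 1) (by omega)]
    exact does_popIte_nil (t := 1) List.drop_length does_skip

theorem does_readBit (m : Memory) (w : List Bool) (k : ℕ) :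
    readBit.Does (m.headAt w k).contents
      (headAt { m with flag := if w.getD k false then m.flag + 1 else m.flag } w k).contents 5 := by
  by_cases hk : k < w.length
  · have hw : w.drop k = w[k] :: w.drop (k + 1) := List.drop_eq_getElem_cons hk
    refine does_popIte_cons (b := w[k]) (l := w.drop (k + 1)) hw (v := some w[k]) (t := 3) ?_
    have h := runs_push (v := some w[k])
      (s := update (m.headAt w k).contents .input (w.drop (k + 1))) MemoryStack.input
      (fun v => v.getD false)
    have e : update (update (m.headAt w k).contents .input (w.drop (k + 1))) .input
        (w[k] :: w.drop (k + 1)) = (m.headAt w k).contents := by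
      rw [update_input, update_input, ← hw]
      rfl
    simp only [update_self, Option.getD_some] at h
    rw [e] at h
    refine h.seq (t₂ := 2) ?_
    simp only [List.getD_eq_getElem _ _ hk]
    cases hb : w[k] with
    | true =>
      refine Runs.ite_true rfl (t := 1) ?_
      have h1 := runs_push (v := some true) (s := (m.headAt w k).contents) MemoryStack.flag
        (fun _ => true)
      have e1 := update_flag (m.headAt w k) (m.flag + 1)
      rw [show update (m.headAt w k).contents MemoryStack.flag
        (true :: (m.headAt w k).contents MemoryStack.flag) = _ from e1] at h1
      exact h1
    | false => exact Runs.ite_false rfl (t := 1) runs_skip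
  -- Beyond the end nothing is read and the flag stays, in accordance with the default value
  -- `false`.
  · have e : w.getD k false = false := List.getD_eq_default _ _ (Nat.le_of_not_lt hk)
    simp only [e]
    refine (does_popIte_nil (t := 1) ?_ does_skip).mono (by omega)
    exact List.drop_of_length_le (Nat.le_of_not_lt hk)

theorem does_rewind (m : Memory) (w : List Bool) (k : ℕ) :
    rewind.Does (m.headAt w k).contents (m.headAt w 0).contents (w.length * 3 + 2) := by
  -- A position beyond the end counts as the end, so the number of moves is bounded by the length of
  -- the word and not by `k`.
  wlog hk : k ≤ w.length generalizing k
  · rw [headAt_of_length_le m w (by omega)]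
    exact this _ le_rfl
  have h := fun v => runs_popLoop (v := v) (t := 1) (p := push .input fun v => v.getD false)
    (k := MemoryStack.tape) (c := Option.isSome) (fun j => (m.headAt w j).contents) k
    (by simp [contents, headAt])
    fun j hj => by
      have hj' : j < w.length := by omega
      have e : (m.headAt w (j + 1)).contents .tape = w[j] :: (w.take j).reverse := by
        simp only [contents, headAt, List.take_succ_eq_append_getElem hj', List.reverse_append]
        rfl
      rw [e]
      refine ⟨rfl, some w[j], ?_⟩
      have h := runs_push (v := some w[j]) (s := update (m.headAt w (j + 1)).contents .tape
        (w.take j).reverse) MemoryStack.input (fun v => v.getD false)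
      have e1 : update (update (m.headAt w (j + 1)).contents .tape (w.take j).reverse) .input
          (w[j] :: w.drop (j + 1)) = (m.headAt w j).contents := by
        rw [update_tape, update_input, ← List.drop_eq_getElem_cons hj']
        rfl
      rw [← e1]
      exact h
  have e : update (m.headAt w 0).contents .tape ((m.headAt w 0).contents .tape).tail
      = (m.headAt w 0).contents := by
    rw [update_tape]
    rfl
  rw [e] at h
  exact fun v => ⟨_, (h v).mono (by omega)⟩

theorem does_forRange_moveHead (m : Memory) (hm : m.tmp = 0) (w : List Bool) (k : ℕ)
    {x x' y : Register} (hx : x ≠ x') (hy : x ≠ y) (h0 : m.reg x = 0)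
    (h0' : m.reg x' = 0) :
    (forRange x x' y moveHead).Does (m.headAt w k).contents
      (m.headAt w (k + m.reg y)).contents (m.reg y * 16 + 8) := by
  have h := does_forRange (p := moveHead) (t := 3) hx hy m.reg h0 h0'
    (fun j => m.headAt w (k + (m.reg y - j))) hm fun j hj => by
      have := does_moveHead
        (m.withReg (update (update m.reg x j) x' (m.reg y - 1 - j))) w (k + (m.reg y - (j + 1)))
      rw [show k + (m.reg y - (j + 1)) + 1 = k + (m.reg y - j) by omega] at this
      exact this
  simp only [tsub_self, add_zero, tsub_zero] at h
  exact h

theorem does_moveHeadMul (m : Memory) (hm : m.tmp = 0) (w : List Bool) (k : ℕ) {x y : Register}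
    (hx : x.val < 18) (hy : y.val < 18) (h0 : ∀ z : Register, 18 ≤ z.val → m.reg z = 0) :
    (moveHeadMul x y).Does (m.headAt w k).contents
      (m.headAt w (k + m.reg x * m.reg y)).contents (m.reg x * (m.reg y * 16 + 21) + 8) := by
  have ne {a b : Register} (ha : a.val < 18) (hb : 18 ≤ b.val) : b ≠ a := by
    rintro rfl
    omega
  have h := does_forRange (p := forRange 20 21 y moveHead) (t := m.reg y * 16 + 8)
    (x := 18) (x' := 19) (y := x) (by decide) (ne hx (by decide)) m.reg
    (h0 _ (by decide)) (h0 _ (by decide))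
    (fun j => m.headAt w (k + (m.reg x - j) * m.reg y)) hm fun j hj => by
      have hy2 : update (update m.reg 18 j) 19 (m.reg x - 1 - j) y = m.reg y := by
        rw [update_of_ne (ne hy (by decide)).symm, update_of_ne (ne hy (by decide)).symm]
      have := does_forRange_moveHead
        (m.withReg (update (update m.reg 18 j) 19 (m.reg x - 1 - j))) hm w
        (k + (m.reg x - (j + 1)) * m.reg y) (x := 20) (x' := 21) (y := y) (by decide)
        (ne hy (by decide))
        (by simpa [withReg, update] using h0 20 (by decide))
        (by simpa [withReg, update] using h0 21 (by decide))
      rw [show (m.withReg (update (update m.reg 18 j) 19 (m.reg x - 1 - j))).reg y = m.reg y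
        from hy2] at this
      rw [show m.reg x - j = m.reg x - (j + 1) + 1 by omega, add_mul, one_mul, ← add_assoc]
      exact this
  simp only [tsub_self, zero_mul, add_zero, tsub_zero] at h
  exact h.mono (le_of_eq (by ring))

/-- A bound for the number of steps of a test. -/
noncomputable def cost : Polynomial ℕ := 32 * Polynomial.X ^ 2 + 61 * Polynomial.X + 50

theorem does_program (a : Test) (ha : a.Valid) (m : Memory) (hm : m.tape = []) (hm' : m.tmp = 0)
    (hm'' : m.flag = 0) (h0 : ∀ z : Register, 18 ≤ z.val → m.reg z = 0) (B : ℕ)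
    (hB : ∀ z, m.reg z ≤ B) (hw : m.input.length ≤ B) :
    a.program.Does m.contents
      (contents { m with flag := if a.eval m.input m.reg then 1 else 0 }) (cost.eval B) := by
  have hc : cost.eval B = 32 * B ^ 2 + 61 * B + 50 := by simp [cost]
  rw [hc]
  obtain ⟨w, o, t, tmp, flag, ρ⟩ := m
  simp only at hm hm' hm'' h0 hB hw
  subst hm hm' hm''
  have ne {a b : Register} (ha : a.val < 18) (hb : 18 ≤ b.val) : a ≠ b := by
    rintro rfl
    omega
  cases a with
  | eq x y =>
    obtain ⟨hx, hy⟩ := ha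
    have h1 := does_addTo ⟨w, o, [], 0, 0, ρ⟩ rfl (ne hx (b := 18) (by decide)).symm
    have h2 := does_addTo ⟨w, o, [], 0, 0, update ρ 18 (ρ x)⟩ rfl
      (ne hy (b := 20) (by decide)).symm
    -- The copies of `x` and `y` are cancelled against each other; the surplus of `x` goes to the
    -- flag here and that of `y` in `h4`. With truncated subtraction the flag ends as `(ρ x - ρ y) +
    -- (ρ y - ρ x)`, which vanishes iff the numbers agree.
    have h3 := does_countdown_reg (p := popIte (.reg 20) Option.isSome skip
      (push .flag fun _ => true)) (t := 3) 18
      (fun j => ⟨w, o, [], 0, (ρ x - j) - ρ y,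
        update (update ρ 18 j) 20 (ρ y - (ρ x - j))⟩) (ρ x)
      (fun j _ => by simp [update]) fun j hj => by
        refine does_popIte_isSome (a := ρ y - (ρ x - (j + 1))) (t := 1) ?_ ?_ ?_
        · simp [contents, withReg, update]
        · intro h
          refine (does_push_flag _).of_eq (congrArg contents ?_)
          simp only [withReg, Memory.mk.injEq, true_and]
          refine ⟨by omega, funext fun k => ?_⟩
          by_cases h18 : k = 18
          · subst h18
            simp [update]
          · by_cases h20 : k = 20
            · subst h20
              simp [update]
              omega
            · simp [update, h18, h20]
        · intro a' h
          rw [update_reg]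
          refine does_skip.of_eq (congrArg contents ?_)
          simp only [withReg, Memory.mk.injEq, true_and]
          refine ⟨by omega, funext fun k => ?_⟩
          by_cases h18 : k = 18
          · subst h18
            simp [update]
          · by_cases h20 : k = 20
            · subst h20
              simp [update]
              omega
            · simp [update, h18, h20]
    have h4 := does_countdown_reg (p := push .flag fun _ => true) (t := 1) 20
      (fun j => ⟨w, o, [], 0, (ρ x - ρ y) + ((ρ y - ρ x) - j), update ρ 20 j⟩) (ρ y - ρ x)
      (fun j _ => by simp [update]) fun j hj => by
        refine (does_push_flag _).of_eq (congrArg contents ?_)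
        simp only [withReg, update_idem]
        congr 1
        omega
    -- The flag is negated: a nonzero value is erased, zero becomes one.
    have h5 : (popIte .flag Option.isSome (popLoop .flag Option.isSome skip)
        (push .flag fun _ => true)).Does
        (contents ⟨w, o, [], 0, (ρ x - ρ y) + (ρ y - ρ x), ρ⟩)
        (contents ⟨w, o, [], 0, if ρ x = ρ y then 1 else 0, ρ⟩)
        (2 + (((ρ x - ρ y) + (ρ y - ρ x)) * 3 + 2)) := by
      refine does_popIte_isSome (a := (ρ x - ρ y) + (ρ y - ρ x)) rfl ?_ ?_
      · intro h
        rw [if_pos (by omega)]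
        refine ((does_push_flag _).of_eq (congrArg contents ?_)).mono (by omega)
        rw [h]
      · intro a' h
        rw [if_neg (by omega), h, update_flag]
        refine (does_countdown_flag (p := skip) (t := 1)
          (fun j => ⟨w, o, [], 0, j, ρ⟩) a' (fun j _ => rfl) fun j hj => does_skip).mono ?_
        omega
    have e18 : update ρ 18 0 = ρ := by rw [← h0 18 (by decide), update_eq_self]
    have e20 : update ρ 20 0 = ρ := by rw [← h0 20 (by decide), update_eq_self]
    simp only [withReg, h0 18 (by decide), zero_add] at h1
    simp only [withReg, update_of_ne (show (20 : Register) ≠ 18 by decide), h0 20 (by decide),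
      update_of_ne (ne hy (b := 18) (by decide)), zero_add] at h2
    simp only [tsub_self, zero_tsub, tsub_zero, e18] at h3
    simp only [tsub_self, add_zero, tsub_zero, e20] at h4
    have hX := hB x
    have hY := hB y
    simp only [eval, decide_eq_true_eq]
    exact (h1.seq (h2.seq (h3.seq (h4.seq h5)))).mono (by omega)
  | bit h x y =>
    obtain ⟨hx, hy⟩ := ha
    have hz : (0 : Register).val < 18 := by decide
    -- The head moves by two products and one further register; two such terms, `16 * B + 8` for the
    -- last move and `3 * B + 2` for rewinding give the leading coefficients of `cost`.
    have mul_le (a b : Register) : ρ a * (ρ b * 16 + 21) + 8 ≤ 16 * B ^ 2 + 21 * B + 8 :=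
      calc ρ a * (ρ b * 16 + 21) + 8 ≤ B * (B * 16 + 21) + 8 := by gcongr <;> exact hB _
        _ = _ := by ring
    have h1 : (if h then moveHeadMul 0 0 else skip).Does
        (headAt ⟨w, o, [], 0, 0, ρ⟩ w 0).contents
        (headAt ⟨w, o, [], 0, 0, ρ⟩ w (if h then ρ 0 * ρ 0 else 0)).contents
        (16 * B ^ 2 + 21 * B + 8) := by
      cases h with
      | true =>
        have := does_moveHeadMul ⟨w, o, [], 0, 0, ρ⟩ rfl w 0 hz hz h0
        rw [zero_add] at this
        exact this.mono (mul_le 0 0)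
      | false => exact does_skip.mono (by omega)
    have h2 := does_moveHeadMul ⟨w, o, [], 0, 0, ρ⟩ rfl w (if h then ρ 0 * ρ 0 else 0) hx hz h0
    have h3 := does_forRange_moveHead ⟨w, o, [], 0, 0, ρ⟩ rfl w
      ((if h then ρ 0 * ρ 0 else 0) + ρ x * ρ 0) (x := 18) (x' := 19) (y := y) (by decide)
      (ne hy (by decide)).symm (h0 _ (by decide)) (h0 _ (by decide))
    have h4 := does_readBit ⟨w, o, [], 0, 0, ρ⟩ w
      ((if h then ρ 0 * ρ 0 else 0) + ρ x * ρ 0 + ρ y)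
    have h5 := does_rewind ⟨w, o, [], 0,
      if w.getD ((if h then ρ 0 * ρ 0 else 0) + ρ x * ρ 0 + ρ y) false then 1 else 0, ρ⟩ w
      ((if h then ρ 0 * ρ 0 else 0) + ρ x * ρ 0 + ρ y)
    have hx0 := mul_le x 0
    have hY := hB y
    exact (h1.seq (h2.seq (h3.seq (h4.seq h5)))).mono (by simp only; omega)

end Test

/-! ## Generators of words -/

/-- Programs that write a word, with nested loops over the values of registers and tests. -/
inductive Generator : Type
  | nothing : Generator
  | emit (b : Bool) : Generator
  | seq (p q : Generator) : Generator
  | ite (a : Test) (p q : Generator) : Generator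
  | forRange (x x' y : Register) (p : Generator) : Generator

namespace Generator

open StackProgram Function

/-- The word that a generator writes. In a loop, `x` runs through the numbers below `y`, and `x'`
is the complementary number. -/
def word (w : List Bool) : Generator → (Register → ℕ) → List Bool
  | nothing, _ => []
  | emit b, _ => [b]
  | seq p q, ρ => p.word w ρ ++ q.word w ρ
  | ite a p q, ρ => if a.eval w ρ then p.word w ρ else q.word w ρ
  | forRange x x' y p, ρ => (List.range (ρ y)).flatMap fun i =>
      p.word w (update (update ρ x i) x' (ρ y - 1 - i))

/-- The loops bind registers from `k` on, in increasing order, below the reserved ones. -/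
def Valid : Generator → ℕ → Prop
  | nothing, _ => True
  | emit _, _ => True
  | seq p q, k => p.Valid k ∧ q.Valid k
  | ite a p q, k => a.Valid ∧ p.Valid k ∧ q.Valid k
  | forRange x x' y p, k =>
    k ≤ x.val ∧ x.val < x'.val ∧ x'.val < 18 ∧ y.val < x.val ∧ p.Valid (x'.val + 1)

/-- The stack program of a generator; the word is written from its end. -/
def program : Generator → StackProgram MemoryStack
  | nothing => skip
  | emit b => push .output fun _ => b
  | seq p q => q.program.seq p.program
  | ite a p q => a.program.seq (popIte .flag Option.isSome p.program q.program)
  | forRange x x' y p => StackProgram.forRange x x' y p.program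

/-- A bound for the number of steps. -/
noncomputable def cost : Generator → Polynomial ℕ
  | nothing => 1
  | emit _ => 1
  | seq p q => p.cost + q.cost
  | ite _ p q => Test.cost + 2 + p.cost + q.cost
  | forRange _ _ _ p => Polynomial.X * (p.cost + 13) + 8

/-- The output is a stack, so each word is put in front of `o`: the second program of a sequence
runs first, and loops that count downwards write in increasing order. That all registers from `k` on
are zero provides fresh counters; the body of a loop is treated with a larger `k`. -/
theorem does_program (w : List Bool) {B : ℕ} (hw : w.length ≤ B) (p : Generator) {k : ℕ}
    (hp : p.Valid k) (hk : k ≤ 18) (o : List Bool) (ρ : Register → ℕ)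
    (h0 : ∀ z : Register, k ≤ z.val → ρ z = 0) (hB : ∀ z, ρ z ≤ B) :
    p.program.Does (Memory.contents ⟨w, o, [], 0, 0, ρ⟩)
      (Memory.contents ⟨w, p.word w ρ ++ o, [], 0, 0, ρ⟩) (p.cost.eval B) := by
  induction p generalizing k o ρ with
  | nothing => exact does_skip.mono (by simp [cost])
  | emit b => exact (does_push_output ⟨w, o, [], 0, 0, ρ⟩ b).mono (by simp [cost])
  | seq p q ihp ihq =>
    have h := (ihq hp.2 hk o ρ h0 hB).seq (ihp hp.1 hk (q.word w ρ ++ o) ρ h0 hB)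
    rw [← List.append_assoc] at h
    exact h.mono (by simp [cost, add_comm])
  | ite a p q ihp ihq =>
    have h1 := Test.does_program a hp.1 ⟨w, o, [], 0, 0, ρ⟩ rfl rfl rfl
      (fun z hz => h0 z (hk.trans hz)) B hB hw
    refine (h1.seq (does_popIte_isSome (a := if a.eval w ρ then 1 else 0)
      (t := p.cost.eval B + q.cost.eval B) rfl ?_ ?_)).mono (by simp [cost]; omega)
    · intro h
      have ha : a.eval w ρ = false := by simpa using h
      simp only [ha, word]
      exact (ihq hp.2.2 hk o ρ h0 hB).mono (by omega)
    · intro a' h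
      have ha : a.eval w ρ = true := by
        by_contra hf
        simp [hf] at h
      have ha' : a' = 0 := by
        simp [ha] at h
        omega
      rw [ha', Memory.update_flag]
      simp only [ha, word]
      exact (ihp hp.2.1 hk o ρ h0 hB).mono (by omega)
  | forRange x x' y p ih =>
    obtain ⟨hx, hxx', hx', hy, hp⟩ := hp
    have ne {a b : Register} (h : a.val < b.val) : a ≠ b := by
      rintro rfl
      omega
    have h := does_forRange (p := p.program) (t := p.cost.eval B) (ne hxx') (ne hy).symm ρ
      (h0 x hx) (h0 x' (by omega))
      -- With `j` rounds left, the words for the indices `j, …, ρ y - 1` have been written.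
      (fun j => ⟨w, ((List.range (ρ y)).drop j).flatMap (fun i =>
        p.word w (update (update ρ x i) x' (ρ y - 1 - i))) ++ o, [], 0, 0, ρ⟩) rfl
      fun j hj => by
        have := ih hp (by omega) (((List.range (ρ y)).drop (j + 1)).flatMap (fun i =>
          p.word w (update (update ρ x i) x' (ρ y - 1 - i))) ++ o)
          (update (update ρ x j) x' (ρ y - 1 - j))
          (fun z hz => by
            rw [update_of_ne (ne (by omega)).symm, update_of_ne (ne (by omega)).symm]
            exact h0 z (by omega))
          (fun z => by
            have := hB y
            by_cases h1 : z = x'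
            · subst h1
              simp
              omega
            · by_cases h2 : z = x
              · subst h2
                simp [h1]
                omega
              · simpa [h1, h2] using hB z)
        rw [← List.append_assoc] at this
        have e : (List.range (ρ y)).drop j = j :: (List.range (ρ y)).drop (j + 1) := by
          rw [List.drop_eq_getElem_cons (by simpa using hj), List.getElem_range]
        rw [e, List.flatMap_cons]
        exact this
    have e : (List.range (ρ y)).drop (ρ y) = [] := List.drop_of_length_le (by simp)
    rw [e] at h
    refine h.mono ?_
    have := hB y
    simp only [cost, Polynomial.eval_add, Polynomial.eval_mul, Polynomial.eval_X,
      Polynomial.eval_ofNat]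
    gcongr

/-- Read a number in unary from the input; put it into register `0` and its successor into
register `1`. -/
def readSize : StackProgram MemoryStack :=
  (popLoop .input (fun v => v.getD false)
    ((push (.reg 0) fun _ => true).seq (push (.reg 1) fun _ => true))).seq
    (push (.reg 1) fun _ => true)

/-- Delete the input. -/
def clearInput : StackProgram MemoryStack := popLoop .input Option.isSome skip

/-- The registers at the beginning of the execution of a generator. -/
def initialReg (n : ℕ) : Register → ℕ := update (update (fun _ => 0) 0 n) 1 (n + 1)

/-- The pop that ends the loop also consumes the end marker, so exactly the rest `w` remains as
input. -/
theorem does_readSize (n : ℕ) (w : List Bool) :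
    readSize.Does (Memory.contents ⟨unaryWord n ++ w, [], [], 0, 0, fun _ => 0⟩)
      (Memory.contents ⟨w, [], [], 0, 0, initialReg n⟩) (n * 4 + 3) := by
  have h1 := does_popLoop (t := 2) (p := (push (MemoryStack.reg 0) fun _ => true).seq
      (push (MemoryStack.reg 1) fun _ => true)) (k := MemoryStack.input)
      (c := fun v => v.getD false)
    (fun j => Memory.contents ⟨unaryWord j ++ w, [], [], 0, 0,
      update (update (fun _ => 0) 0 (n - j)) 1 (n - j)⟩) n rfl
    fun j hj => by
      refine ⟨rfl, ?_⟩
      rw [Memory.update_input]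
      refine ((does_push_reg _ 0).seq (does_push_reg _ 1)).of_eq (congrArg Memory.contents ?_)
      simp only [Memory.withReg, Memory.mk.injEq, true_and]
      refine ⟨rfl, ?_⟩
      funext k
      by_cases k1 : k = 1
      · subst k1
        simp [update]
        omega
      · by_cases k2 : k = 0
        · subst k2
          simp [update]
          omega
        · simp [update, k1, k2]
  rw [Memory.update_input] at h1
  have e : update (update (fun _ : Register => 0) 0 (n - n)) 1 (n - n) = fun _ => 0 := by
    funext k
    simp [update]
  rw [e] at h1
  refine (h1.seq ((does_push_reg _ 1).of_eq (congrArg Memory.contents ?_))).mono (by omega)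
  simp only [tsub_zero, Memory.withReg, Memory.mk.injEq, true_and]
  refine ⟨rfl, ?_⟩
  funext k
  by_cases k1 : k = 1
  · subst k1
    simp [update, initialReg]
  · simp [update, initialReg, k1]

theorem does_clearInput (w o : List Bool) (ρ : Register → ℕ) :
    clearInput.Does (Memory.contents ⟨w, o, [], 0, 0, ρ⟩)
      (Memory.contents ⟨[], o, [], 0, 0, ρ⟩) (w.length * 3 + 2) := by
  have h := does_popLoop (t := 1) (p := skip) (k := MemoryStack.input) (c := Option.isSome)
    (fun j => Memory.contents ⟨w.drop (w.length - j), o, [], 0, 0, ρ⟩) w.length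
    (by simp [Memory.contents])
    fun j hj => by
      have e : w.drop (w.length - (j + 1))
          = w[w.length - (j + 1)] :: w.drop (w.length - j) := by
        rw [List.drop_eq_getElem_cons (by omega),
          show w.length - (j + 1) + 1 = w.length - j by omega]
      rw [Memory.update_input]
      simp only [e]
      exact ⟨rfl, does_skip⟩
  rw [Memory.update_input] at h
  simp only [tsub_self, List.drop_zero, Memory.contents, tsub_zero, List.drop_length,
    List.tail_nil] at h
  exact h

/-- The functions computed by generators are computable in polynomial time. -/
theorem nonempty_computable {α β : Type} {ea : α → List Bool} {eb : β → List Bool} {f : α → β}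
    (p : Generator) (hp : p.Valid 2) (n : α → ℕ) (w : α → List Bool)
    (ha : ∀ a, ea a = unaryWord (n a) ++ w a)
    (hb : ∀ a, eb (f a) = p.word (w a) (initialReg (n a))) :
    Nonempty (TM2ComputableInPolyTime ea eb f) := by
  -- A final configuration must have all stacks empty except the output, and the initial register
  -- value. The input and the two size registers are therefore erased, and popping the empty stack
  -- `tmp` sets the register to `none`.
  refine Runs.nonempty_computable (readSize.seq (p.program.seq (clearInput.seq
    ((clear 0).seq ((clear 1).seq (pop .tmp)))))) MemoryStack.input MemoryStack.output
    (p.cost + (13 * Polynomial.X + 10)) fun a => ?_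
  have hl : (ea a).length = n a + 1 + (w a).length := by
    simp [ha, unaryWord]
    omega
  have h1 := does_readSize (n a) (w a)
  have h2 := does_program (w a) (B := (ea a).length) (by omega) p hp (by omega) []
    (initialReg (n a))
    (fun z hz => by
      have z0 : z ≠ 0 := by rintro rfl; simp at hz
      have z1 : z ≠ 1 := by rintro rfl; simp at hz
      simp [initialReg, z0, z1])
    (fun z => by
      simp only [initialReg, update_apply]
      split_ifs <;> omega)
  rw [List.append_nil, ← hb] at h2
  have h3 := does_clearInput (w a) (eb (f a)) (initialReg (n a))
  have h4 := does_clear ⟨[], eb (f a), [], 0, 0, initialReg (n a)⟩ 0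
  have h5 := does_clear ⟨[], eb (f a), [], 0, 0, update (initialReg (n a)) 0 0⟩ 1
  have h6 : Memory.withReg ⟨[], eb (f a), [], 0, 0, update (initialReg (n a)) 0 0⟩
      (update (update (initialReg (n a)) 0 0) 1 0)
      = ⟨[], eb (f a), [], 0, 0, fun _ => 0⟩ := by
    simp only [Memory.withReg, Memory.mk.injEq, true_and]
    funext k
    simp only [initialReg, update_apply]
    split_ifs <;> rfl
  rw [h6] at h5
  obtain ⟨v1, h1⟩ := h1 none
  obtain ⟨v2, h2⟩ := h2 v1
  obtain ⟨v3, h3⟩ := h3 v2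
  obtain ⟨v4, h4⟩ := h4 v3
  obtain ⟨v5, h5⟩ := h5 v4
  have h7 := runs_pop (v := v5) (s := Memory.contents ⟨[], eb (f a), [], 0, 0, fun _ => 0⟩)
    MemoryStack.tmp
  have e1 : Memory.contents ⟨ea a, [], [], 0, 0, fun _ => 0⟩
      = update (fun _ => []) MemoryStack.input (ea a) := by
    funext k
    cases k <;> rfl
  have e2 : update (Memory.contents ⟨[], eb (f a), [], 0, 0, fun _ => 0⟩) MemoryStack.tmp
      (Memory.contents ⟨[], eb (f a), [], 0, 0, fun _ => 0⟩ MemoryStack.tmp).tail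
      = update (fun _ => []) MemoryStack.output (eb (f a)) := by
    funext k
    cases k <;> rfl
  rw [← ha, e1] at h1
  rw [e2] at h7
  refine (h1.seq (h2.seq (h3.seq (h4.seq (h5.seq h7))))).mono ?_
  simp [initialReg, update]
  omega

end Generator

/-! ## Preference lists from lists of agents -/

/-- The preference list that is given by a list of all agents. -/
def PrefList.ofList {N : ℕ} (l : List (Fin N)) (hl : l.Nodup) (hm : ∀ a, a ∈ l) : PrefList N :=
  (finCongr (by
    have := Fintype.card_congr (hl.getEquivOfForallMemList l hm)
    simpa using this.symm)).trans (hl.getEquivOfForallMemList l hm)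

theorem PrefList.ofFn_ofList {N : ℕ} (l : List (Fin N)) (hl : l.Nodup) (hm : ∀ a, a ∈ l) :
    (List.ofFn fun k => ((ofList l hl hm k : Fin N) : ℕ)) = l.map Fin.val := by
  have e : l.length = N := by
    have := Fintype.card_congr (hl.getEquivOfForallMemList l hm)
    simpa using this
  refine List.ext_getElem (by simp [e]) fun i h1 h2 => ?_
  simp [ofList]

theorem List.Pairwise.of_idxOf_lt {α : Type} [DecidableEq α] {R : α → α → Prop} {l : List α}
    (h : l.Pairwise R) {a b : α} (hb : b ∈ l) (hab : l.idxOf a < l.idxOf b) : R a b := by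
  have hb' := List.idxOf_lt_length_of_mem hb
  have := List.pairwise_iff_getElem.1 h _ _ (hab.trans hb') hb' hab
  simpa using this

/-- A list sorted by an asymmetric relation, in which every agent occurs, determines that relation:
asymmetry excludes that a later agent is related to an earlier one. -/
theorem PrefList.ofList_prefers_iff {N : ℕ} {l : List (Fin N)} (hl : l.Nodup) (hm : ∀ a, a ∈ l)
    {R : Fin N → Fin N → Prop} (hR : l.Pairwise R) (hasymm : ∀ a b, R a b → ¬ R b a)
    (a b : Fin N) : (ofList l hl hm).Prefers a b ↔ R a b := by
  have key : (ofList l hl hm).Prefers a b ↔ l.idxOf a < l.idxOf b := by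
    simp [Prefers, ofList, Fin.lt_def]
  rw [key]
  refine ⟨hR.of_idxOf_lt (hm b), fun h => ?_⟩
  by_contra hlt
  rcases Nat.lt_or_eq_of_le (Nat.le_of_not_lt hlt) with h1 | h1
  · exact hasymm a b h (hR.of_idxOf_lt (hm a) h1)
  · have : b = a := (List.idxOf_inj (hm b)).1 h1
    subst this
    exact hasymm _ _ h h

/-- Stable sorting of a list by keys `0`, `1`, `2`. -/
def List.sortByKey {α : Type} (f : α → ℕ) (l : List α) : List α :=
  l.filter (fun a => f a = 0) ++ (l.filter (fun a => f a = 1) ++ l.filter (fun a => f a = 2))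

theorem List.mem_sortByKey {α : Type} {f : α → ℕ} (hf : ∀ a, f a < 3) {l : List α} {a : α} :
    a ∈ l.sortByKey f ↔ a ∈ l := by
  have := hf a
  simp only [sortByKey, List.mem_append, List.mem_filter, decide_eq_true_eq]
  constructor
  · rintro (h | h | h) <;> exact h.1
  · intro h
    simp only [h, true_and]
    omega

theorem List.Pairwise.sortByKey {α : Type} {f : α → ℕ} {l : List α} {R : α → α → Prop}
    (h : l.Pairwise R) :
    (l.sortByKey f).Pairwise fun a b => f a < f b ∨ (f a = f b ∧ R a b) := by
  have block (s : ℕ) : (l.filter (fun a => f a = s)).Pairwise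
      fun a b => f a < f b ∨ (f a = f b ∧ R a b) := by
    refine (h.filter _).imp_of_mem fun {a b} ha hb hab => ?_
    simp only [List.mem_filter, decide_eq_true_eq] at ha hb
    exact Or.inr ⟨ha.2.trans hb.2.symm, hab⟩
  unfold List.sortByKey
  simp only [List.pairwise_append, block, true_and, List.mem_append, List.mem_filter,
    decide_eq_true_eq]
  refine ⟨fun a ha b hb => Or.inl ?_, fun a ha b hb => Or.inl ?_⟩ <;> omega

theorem List.Nodup.sortByKey {α : Type} {f : α → ℕ} {l : List α}
    (h : l.Nodup) : (l.sortByKey f).Nodup := by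
  -- `Nodup` is pairwise `≠`, and the lexicographic relation built from `≠` is still irreflexive.
  refine (List.Pairwise.sortByKey (f := f) h).imp fun {a b} hab => ?_
  rintro rfl
  simp at hab

/-! ## Multi-layer preferences from two digraphs -/

section Digraph

variable {N : ℕ} (r : Fin N → Fin N → Bool)

/-- The first preference list for agent `a` is `a`, the out-neighbours of `a`, the other agents;
the second one is obtained by reversing each of these three parts, and moving the last one to the
front. The rank is the number of the part. -/
def arcRank (t : Bool) (a b : Fin N) : ℕ :=
  match t with
  | false => if b = a then 0 else if r a b then 1 else 2
  | true => if b = a then 1 else if r a b then 2 else 0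

theorem arcRank_lt (t : Bool) (a b : Fin N) : arcRank r t a b < 3 := by
  cases t <;> simp only [arcRank] <;> split_ifs <;> omega

/-- The two preference lists for agent `a` as lists of agents. -/
def arcList (t : Bool) (a : Fin N) : List (Fin N) :=
  (if t then (List.finRange N).reverse else List.finRange N).sortByKey (arcRank r t a)

theorem arcList_nodup (t : Bool) (a : Fin N) : (arcList r t a).Nodup := by
  refine List.Nodup.sortByKey ?_
  cases t
  · simpa using List.nodup_finRange N
  · simpa using List.nodup_finRange N

theorem mem_arcList (t : Bool) (a b : Fin N) : b ∈ arcList r t a := by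
  rw [arcList, List.mem_sortByKey (arcRank_lt r t a)]
  cases t <;> simp

/-- The two preference lists for agent `a`. -/
def arcPref (t : Bool) (a : Fin N) : PrefList N :=
  PrefList.ofList _ (arcList_nodup r t a) (mem_arcList r t a)

theorem arcPref_false_prefers (a b c : Fin N) : (arcPref r false a).Prefers b c ↔
    arcRank r false a b < arcRank r false a c ∨
      (arcRank r false a b = arcRank r false a c ∧ b < c) := by
  refine PrefList.ofList_prefers_iff (R := fun b c => arcRank r false a b < arcRank r false a c ∨
    (arcRank r false a b = arcRank r false a c ∧ b < c)) _ _ ?_ ?_ b c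
  · exact (List.pairwise_lt_finRange N).sortByKey
  · intro b c h
    omega

theorem arcPref_true_prefers (a b c : Fin N) : (arcPref r true a).Prefers b c ↔
    arcRank r true a b < arcRank r true a c ∨
      (arcRank r true a b = arcRank r true a c ∧ c < b) := by
  refine PrefList.ofList_prefers_iff (R := fun b c => arcRank r true a b < arcRank r true a c ∨
    (arcRank r true a b = arcRank r true a c ∧ c < b)) _ _ ?_ ?_ b c
  · exact (List.pairwise_reverse.2 (List.pairwise_lt_finRange N)).sortByKey
  · intro b c h
    omega

-- Within a part the two lists disagree because the order is reversed. Between parts, moving the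
-- others to the front reverses their comparison with `a` and with the out-neighbours. Only `a`
-- against an out-neighbour is decided alike twice. The loss term stands on the left to avoid
-- subtraction.
open Classical in
theorem arcPref_prefers_add {b c : Fin N} (h : b ≠ c) (a : Fin N) :
    (if (arcPref r false a).Prefers b c then 1 else 0)
      + (if (arcPref r true a).Prefers b c then 1 else 0)
      + (if c = a then (if r c b then 1 else 0) else 0)
      = 1 + (if b = a then (if r b c then 1 else 0) else 0) := by
  have hlt : b < c ∨ c < b := lt_or_gt_of_ne h
  have hlt' : ¬ (b < c ∧ c < b) := fun h => lt_asymm h.1 h.2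
  rw [arcPref_false_prefers, arcPref_true_prefers]
  simp only [arcRank]
  by_cases hb : b = a
  · subst hb
    by_cases hbc : r b c <;> simp [h.symm, hbc]
  · by_cases hc : c = a
    · subst hc
      by_cases hcb : r c b <;> simp [h, hcb]
    · by_cases h1 : r a b <;> by_cases h2 : r a c <;> rcases hlt with hlt | hlt <;>
        simp [hb, hc, h1, h2, hlt, hlt.le]

/-- The preference list in layer `i`. -/
def layerPref (i : Fin (N * 2)) : PrefList N :=
  arcPref r (decide ((finProdFinEquiv.symm i).2 = 1)) (finProdFinEquiv.symm i).1

-- Summation over `a`: each agent contributes one layer, and only `a = b` and `a = c` can contribute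
-- a correction.
open Classical in
theorem card_layerPref_prefers {b c : Fin N} (h : b ≠ c) :
    (Finset.univ.filter fun i => (layerPref r i).Prefers b c).card + (if r c b then 1 else 0)
      = N + (if r b c then 1 else 0) := by
  have h1 : (Finset.univ.filter fun i => (layerPref r i).Prefers b c).card
      = ∑ a : Fin N, ((if (arcPref r false a).Prefers b c then 1 else 0)
        + (if (arcPref r true a).Prefers b c then 1 else 0)) := by
    rw [Finset.card_filter, ← Equiv.sum_comp finProdFinEquiv, Fintype.sum_prod_type]
    simp only [layerPref, Equiv.symm_apply_apply, Fin.sum_univ_two]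
    rfl
  have h2 := Finset.sum_congr (s₁ := Finset.univ) rfl
    fun a (_ : a ∈ Finset.univ) => arcPref_prefers_add r h a
  rw [Finset.sum_add_distrib, Finset.sum_add_distrib (f := fun _ => 1)] at h2
  rw [h1]
  simpa using h2

/-- The threshold `N` is missed only at the count `N - 1`. Asymmetry of `r` ensures that an arc from
`c` to `b` is not compensated by an opposite one. -/
theorem exists_layers_prefer_iff (hr : ∀ a b, r a b = true → r b a = false) {b c : Fin N} (h : b ≠ c) :
    (∃ S : Finset (Fin (N * 2)), S.card = N ∧ ∀ i ∈ S, (layerPref r i).Prefers b c) ↔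
      r c b = false := by
  classical
  have h1 := card_layerPref_prefers r h
  constructor
  · rintro ⟨S, hS, hS'⟩
    have h2 : S.card ≤ (Finset.univ.filter fun i => (layerPref r i).Prefers b c).card :=
      Finset.card_le_card fun i hi => by simpa using hS' i hi
    by_contra hf
    have hcb : r c b = true := by simpa using hf
    have hbc := hr c b hcb
    simp [hcb, hbc] at h1
    omega
  · intro hcb
    have h2 : N ≤ (Finset.univ.filter fun i => (layerPref r i).Prefers b c).card := by
      simp [hcb] at h1
      omega
    obtain ⟨S, hS, hS'⟩ := Finset.exists_subset_card_eq h2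
    exact ⟨S, hS', fun i hi => by simpa using hS hi⟩

end Digraph

/-! ### The marriage instance of two digraphs -/

/-- The instance in which the agents of `W` are compared according to `r`, and those of `U`
according to `r'`. -/
def digraphMarriage {N : ℕ} (hN : 1 ≤ N) (r r' : Fin N → Fin N → Bool) : MultiLayerMarriage where
  n := N
  layers := N * 2
  alpha := N
  one_le_alpha := hN
  alpha_le_layers := by omega
  prefU i _ := layerPref r i
  prefW i _ := layerPref r' i

theorem digraphMarriage_uniform {N : ℕ} (hN : 1 ≤ N) (r r' : Fin N → Fin N → Bool) :
    (digraphMarriage hN r r').Uniform :=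
  fun _ => ⟨fun _ _ => rfl, fun _ _ => rfl⟩

/-- For `u = a` and `w = f b`, agent `a` secures the pair iff `r (f b) (f a)` fails, and agent `f b`
does iff `r' a b` fails. -/
theorem exists_stable_iff {N : ℕ} (hN : 1 ≤ N) {r r' : Fin N → Fin N → Bool}
    (hr : ∀ a b, r a b = true → r b a = false) (hr' : ∀ a b, r' a b = true → r' b a = false) :
    (∃ M : Set (Fin N × Fin N), IsMatching M ∧ (digraphMarriage hN r r').IndividuallyStable M) ↔
      ∃ f : Fin N ≃ Fin N, ∀ a b, r' a b = true → r (f b) (f a) = false := by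
  constructor
  · rintro ⟨M, hM, hs⟩
    have fst {u w w' : Fin N} (h : (u, w) ∈ M) (h' : (u, w') ∈ M) : w = w' := by
      by_contra hne
      exact (hM _ h _ h' (by simp [hne])).1 rfl
    have snd {u u' w : Fin N} (h : (u, w) ∈ M) (h' : (u', w) ∈ M) : u = u' := by
      by_contra hne
      exact (hM _ h _ h' (by simp [hne])).2 rfl
    have total : ∀ u, ∃ w, (u, w) ∈ M := by
      by_contra hne
      push Not at hne
      obtain ⟨u₀, hu₀⟩ := hne
      -- An unmatched `u₀` secures none of its pairs, so every `w` must be matched; by counting, the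
      -- partners of the `w` exhaust `U`, including `u₀`.
      have hw : ∀ w, ∃ u, (u, w) ∈ M := by
        intro w
        obtain ⟨S, -, ⟨w', hw', -⟩ | ⟨u', hu', -⟩⟩ := hs u₀ w (hu₀ w)
        · exact absurd hw' (hu₀ w')
        · exact ⟨u', hu'⟩
      choose g hg using hw
      have ginj : Function.Injective g := fun w w' h => fst (hg w) (h ▸ hg w')
      obtain ⟨w, rfl⟩ := Finite.surjective_of_injective ginj u₀
      exact hu₀ w (hg w)
    choose f hf using total
    have finj : Function.Injective f := fun u u' h => snd (hf u) (h ▸ hf u')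
    refine ⟨Equiv.ofBijective f (Finite.injective_iff_bijective.1 finj), fun a b hab => ?_⟩
    simp only [Equiv.ofBijective_apply]
    have hne : b ≠ a := by
      rintro rfl
      simp [hr' _ _ hab] at hab
    obtain ⟨S, hS, ⟨w', hw', h⟩ | ⟨u', hu', h⟩⟩ := hs a (f b) fun h => hne (snd (hf b) h)
    · obtain rfl := fst (hf a) hw'
      exact (exists_layers_prefer_iff r hr (finj.ne hne.symm)).1 ⟨S, hS, h⟩
    · obtain rfl := snd (hf b) hu'
      have := (exists_layers_prefer_iff r' hr' hne).1 ⟨S, hS, h⟩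
      simp [this] at hab
  · rintro ⟨f, hf⟩
    refine ⟨{p | p.2 = f p.1}, ?_, ?_⟩
    · rintro ⟨u, w⟩ (rfl : w = f u) ⟨u', w'⟩ (rfl : w' = f u') hne
      have : u ≠ u' := by
        rintro rfl
        exact hne rfl
      exact ⟨this, f.injective.ne this⟩
    · intro u w hw
      obtain ⟨u', rfl⟩ := f.surjective w
      have hne : u' ≠ u := by
        rintro rfl
        exact hw rfl
      by_cases h : r' u u' = true
      · obtain ⟨S, hS, h1⟩ := (exists_layers_prefer_iff r hr (f.injective.ne hne.symm)).2
          (hf u u' h)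
        exact ⟨S, hS, Or.inl ⟨f u, rfl, h1⟩⟩
      · obtain ⟨S, hS, h1⟩ := (exists_layers_prefer_iff r' hr' hne).2 (by simpa using h)
        exact ⟨S, hS, Or.inr ⟨u', rfl, h1⟩⟩

/-! ### The encoding of the instance as nested concatenations -/

/-- The word of a preference list that is repeated `N` times. -/
def repeatedWord {N : ℕ} (l : List (Fin N)) : List Bool :=
  (List.finRange N).flatMap fun _ => l.flatMap fun a => unaryWord a.val

theorem natsWord_append (l l' : List ℕ) : natsWord (l ++ l') = natsWord l ++ natsWord l' :=
  List.flatMap_append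

theorem natsWord_flatMap {α : Type} (l : List α) (g : α → List ℕ) :
    natsWord (l.flatMap g) = l.flatMap fun a => natsWord (g a) :=
  List.flatMap_assoc

theorem natsWord_map {α : Type} (l : List α) (g : α → ℕ) :
    natsWord (l.map g) = l.flatMap fun a => unaryWord (g a) :=
  List.flatMap_map g unaryWord l

theorem concatFin_eq_flatMap {β : Type} {m : ℕ} (f : Fin m → List β) :
    concatFin f = (List.finRange m).flatMap f := by
  rw [concatFin, List.ofFn_eq_map, List.flatMap_def]

theorem natsWord_profileNats_arcPref {N : ℕ} (r : Fin N → Fin N → Bool) (t : Bool) (a : Fin N) :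
    natsWord (profileNats fun _ : Fin N => arcPref r t a) = repeatedWord (arcList r t a) := by
  rw [profileNats, concatFin_eq_flatMap, natsWord_flatMap, repeatedWord]
  simp only [arcPref, PrefList.ofFn_ofList, natsWord_map]

theorem finRange_mul_flatMap {β : Type} {m n : ℕ} (g : Fin (m * n) → List β) :
    (List.finRange (m * n)).flatMap g
      = (List.finRange m).flatMap fun i => (List.finRange n).flatMap fun j =>
        g (finProdFinEquiv (i, j)) := by
  have h : List.finRange (m * n) = (List.finRange m).flatMap fun i =>
      (List.finRange n).map fun j => finProdFinEquiv (i, j) := by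
    rw [← List.ofFn_id, List.ofFn_mul, List.flatMap_def, ← List.ofFn_eq_map]
    congr 2
    funext i
    rw [← List.ofFn_eq_map]
    congr 1
    funext j
    simp [Fin.ext_iff, finProdFinEquiv]
    ring
  rw [h, List.flatMap_assoc]
  simp only [List.flatMap_map]

theorem finRange_mul_two_flatMap {β : Type} {N : ℕ} (g : Fin N × Fin 2 → List β) :
    ((List.finRange (N * 2)).flatMap fun i => g (finProdFinEquiv.symm i))
      = (List.finRange N).flatMap fun a => g (a, 0) ++ g (a, 1) := by
  rw [finRange_mul_flatMap]
  simp only [Equiv.symm_apply_apply, List.finRange_succ, List.finRange_zero, List.map_cons,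
    List.map_nil, List.flatMap_cons, List.flatMap_nil, List.append_nil, Fin.succ_zero_eq_one]

/-- Uniformity makes each list occur `N` times in a row, and layers come in pairs indexed by the
agents; this nested form is what a generator with loops can write. -/
theorem encode_digraphMarriage {N : ℕ} (hN : 1 ≤ N) (r r' : Fin N → Fin N → Bool) :
    (digraphMarriage hN r r').encode
      = unaryWord N ++ (unaryWord (N * 2) ++ (unaryWord N ++
        (List.finRange N).flatMap fun a =>
          (repeatedWord (arcList r false a) ++ repeatedWord (arcList r' false a)) ++
          (repeatedWord (arcList r true a) ++ repeatedWord (arcList r' true a)))) := by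
  have h : (digraphMarriage hN r r').encode
      = unaryWord N ++ (unaryWord (N * 2) ++ (unaryWord N ++
        natsWord (concatFin fun i : Fin (N * 2) => profileNats (fun _ : Fin N => layerPref r i)
          ++ profileNats (fun _ : Fin N => layerPref r' i)))) := rfl
  rw [h, concatFin_eq_flatMap, natsWord_flatMap]
  simp only [natsWord_append, layerPref, natsWord_profileNats_arcPref]
  rw [finRange_mul_two_flatMap fun x => repeatedWord (arcList r (decide (x.2 = 1)) x.1) ++
    repeatedWord (arcList r' (decide (x.2 = 1)) x.1)]
  rfl

/-! ## Digraphs that encode graphs -/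

section Gadget

variable {V Z : Type}

/-- The digraph of a graph: its vertices are the elements of `Z`, the vertices of the graph and
the pairs of vertices. There are all arcs from vertices to `Z` and from `Z` to pairs. A pair gets
an arc from its first component and, if it is an edge, from its second component, and it has arcs
to the other vertices. -/
def gadgetArc (G : SimpleGraph V) : Z ⊕ V ⊕ V × V → Z ⊕ V ⊕ V × V → Prop
  | .inl _, .inr (.inr _) => True
  | .inr (.inl _), .inl _ => True
  | .inr (.inl x), .inr (.inr p) => x = p.1 ∨ (x = p.2 ∧ G.Adj p.1 p.2)
  | .inr (.inr p), .inr (.inl x) => ¬ (x = p.1 ∨ (x = p.2 ∧ G.Adj p.1 p.2))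
  | _, _ => False

theorem gadgetArc_asymm (G : SimpleGraph V) (a b : Z ⊕ V ⊕ V × V) (h : gadgetArc G a b) :
    ¬ gadgetArc G b a := by
  rcases a with a | a | a <;> rcases b with b | b | b <;> simp_all [gadgetArc]

theorem exists_map_of_gadgetArc [Fintype V] [Fintype Z] {G H : SimpleGraph V}
    (hZ : Fintype.card (V ⊕ V × V) < Fintype.card Z) (f : Z ⊕ V ⊕ V × V ≃ Z ⊕ V ⊕ V × V)
    (hf : ∀ a b, gadgetArc G a b → ¬ gadgetArc H (f b) (f a)) :
    ∃ φ : V → V, (∀ x, f (.inr (.inl x)) = .inr (.inl (φ x))) ∧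
      ∀ x y, G.Adj x y → H.Adj (φ x) (φ y) := by
  -- Pigeonhole: the gates do not all fit into the set of vertices and pairs.
  obtain ⟨z₀, z₀', hz⟩ : ∃ z z', f (.inl z) = .inl z' := by
    by_contra! hne
    have h : ∀ z, ∃ a, f (.inl z) = .inr a := by
      intro z
      rcases h : f (.inl z) with z' | a
      · exact absurd h (hne z z')
      · exact ⟨a, rfl⟩
    choose g hg using h
    have ginj : Function.Injective g := fun z z' h => by
      have := f.injective ((hg z).trans ((congrArg _ h).trans (hg z').symm))
      simpa using this
    have := Fintype.card_le_of_injective g ginj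
    omega
  -- The arc from `x` to the gate `z₀` would be reversed, as the image of `z₀` is a gate and has
  -- arcs to all pairs. The argument for `hPV` is dual.
  have hVP : ∀ x p, f (.inr (.inl x)) ≠ .inr (.inr p) := fun x p h => by
    have := hf (.inr (.inl x)) (.inl z₀) trivial
    rw [h, hz] at this
    exact this trivial
  have hPV : ∀ x p, f (.inr (.inr p)) ≠ .inr (.inl x) := fun x p h => by
    have := hf (.inl z₀) (.inr (.inr p)) trivial
    rw [h, hz] at this
    exact this trivial
  have hVV : ∀ x, ∃ x', f (.inr (.inl x)) = .inr (.inl x') := by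
    intro x
    rcases h : f (.inr (.inl x)) with z' | x' | p
    -- If some vertex goes to a gate, then no gate goes to a vertex. Every vertex is then the image
    -- of a vertex, and by finiteness vertices go only to vertices, a contradiction.
    · have hZV : ∀ z x', f (.inl z) ≠ .inr (.inl x') := fun z x' h' => by
        have := hf (.inr (.inl x)) (.inl z) trivial
        rw [h, h'] at this
        exact this trivial
      have hg : ∀ x', ∃ y, f (.inr (.inl y)) = .inr (.inl x') := by
        intro x'
        obtain ⟨z | y | p, e⟩ := f.surjective (.inr (.inl x'))
        · exact absurd e (hZV z x')
        · exact ⟨y, e⟩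
        · exact absurd e (hPV x' p)
      choose g hg using hg
      have ginj : Function.Injective g := fun y y' e => by
        have := (hg y).symm.trans ((congrArg (fun a => f (.inr (.inl a))) e).trans (hg y'))
        simpa using this
      obtain ⟨y, rfl⟩ := Finite.surjective_of_injective ginj x
      simp [hg] at h
    · exact ⟨x', rfl⟩
    · exact absurd h (hVP x p)
  have hPP : ∀ p, ∃ p', f (.inr (.inr p)) = .inr (.inr p') := by
    intro p
    rcases h : f (.inr (.inr p)) with z' | x' | p'
    -- The same counting argument for pairs.
    · have hZP : ∀ z p', f (.inl z) ≠ .inr (.inr p') := fun z p' h' => by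
        have := hf (.inl z) (.inr (.inr p)) trivial
        rw [h, h'] at this
        exact this trivial
      have hg : ∀ p', ∃ q, f (.inr (.inr q)) = .inr (.inr p') := by
        intro p'
        obtain ⟨z | y | q, e⟩ := f.surjective (.inr (.inr p'))
        · exact absurd e (hZP z p')
        · exact absurd e (hVP y p')
        · exact ⟨q, e⟩
      choose g hg using hg
      have ginj : Function.Injective g := fun y y' e => by
        have := (hg y).symm.trans ((congrArg (fun a => f (.inr (.inr a))) e).trans (hg y'))
        simpa using this
      obtain ⟨y, rfl⟩ := Finite.surjective_of_injective ginj p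
      simp [hg] at h
    · exact absurd h (hPV x' p)
    · exact ⟨p', rfl⟩
  choose φ hφ using hVV
  choose ψ hψ using hPP
  refine ⟨φ, hφ, fun x y hxy => ?_⟩
  have hne : φ x ≠ φ y := fun e => by
    have h : f (.inr (.inl x)) = f (.inr (.inl y)) := by rw [hφ, hφ, e]
    exact hxy.ne (by simpa using h)
  -- Both `x` and `y` have arcs to the pair `(x, y)`. Between vertices and pairs the absence of one
  -- arc is the presence of the other, so `φ x` and `φ y` are two distinct in-neighbours of the
  -- image pair; they are its two components, and it is an edge.
  have h1 := hf (.inr (.inl x)) (.inr (.inr (x, y))) (Or.inl rfl)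
  have h2 := hf (.inr (.inl y)) (.inr (.inr (x, y))) (Or.inr ⟨rfl, hxy⟩)
  rw [hφ, hψ] at h1 h2
  rcases not_not.1 h1 with e1 | ⟨e1, h⟩ <;> rcases not_not.1 h2 with e2 | ⟨e2, h'⟩
  · exact absurd (e1.trans e2.symm) hne
  · rw [e1, e2]
    exact h'
  · rw [e1, e2]
    exact h.symm
  · exact absurd (e1.trans e2.symm) hne

theorem exists_equiv_gadgetArc_iff [Fintype V] [Fintype Z] {G H : SimpleGraph V}
    (hZ : Fintype.card (V ⊕ V × V) < Fintype.card Z) :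
    (∃ f : Z ⊕ V ⊕ V × V ≃ Z ⊕ V ⊕ V × V,
      ∀ a b, gadgetArc G a b → ¬ gadgetArc H (f b) (f a)) ↔ Nonempty (G ≃g H) := by
  constructor
  · rintro ⟨f, hf⟩
    obtain ⟨φ, hφ, hφ'⟩ := exists_map_of_gadgetArc hZ f hf
    -- By contraposition the inverse of `f` reverses no arc either, now from `H` to `G`.
    obtain ⟨ψ, hψ, hψ'⟩ := exists_map_of_gadgetArc (G := H) (H := G) hZ f.symm fun a b h h' => by
      have := hf _ _ h'
      simp only [Equiv.apply_symm_apply] at this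
      exact this h
    have e1 : ∀ x, ψ (φ x) = x := fun x => by
      have := hψ (φ x)
      rw [← hφ, Equiv.symm_apply_apply] at this
      simpa using this.symm
    have e2 : ∀ x, φ (ψ x) = x := fun x => by
      have := hφ (ψ x)
      rw [← hψ, Equiv.apply_symm_apply] at this
      simpa using this.symm
    refine ⟨⟨⟨φ, ψ, e1, e2⟩, fun {x y} => ⟨fun h => ?_, hφ' x y⟩⟩⟩
    have := hψ' _ _ h
    simpa [e1] using this
  · rintro ⟨φ⟩
    -- The bijection induced by an isomorphism preserves arcs, and by asymmetry a preserved arc is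
    -- not reversed.
    refine ⟨(Equiv.refl Z).sumCongr (φ.toEquiv.sumCongr (φ.toEquiv.prodCongr φ.toEquiv)),
      fun a b h => gadgetArc_asymm H _ _ ?_⟩
    rcases a with a | a | a <;> rcases b with b | b | b <;> simp_all [gadgetArc, φ.map_adj_iff]

end Gadget

/-! ## The agents of the constructed instance -/

/-- The agents for graphs with `n` vertices, i.e. the vertices of the digraph of a graph. -/
abbrev AgentOf (n : ℕ) : Type := (Fin (n + 1) × Fin (n + 1)) ⊕ Fin n ⊕ Fin n × Fin n

/-- The number of agents on each side. -/
def agentCount (n : ℕ) : ℕ := (n + 1) * (n + 1) + (n + n * n)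

/-- The agents are numbered in lexicographic order. -/
def agentEquiv (n : ℕ) : AgentOf n ≃ Fin (agentCount n) :=
  (finProdFinEquiv.sumCongr
    (((Equiv.refl (Fin n)).sumCongr finProdFinEquiv).trans finSumFinEquiv)).trans finSumFinEquiv

theorem finRange_add_flatMap {β : Type} {m n : ℕ} (g : Fin (m + n) → List β) :
    (List.finRange (m + n)).flatMap g
      = (List.finRange m).flatMap (fun i => g (Fin.castAdd n i))
        ++ (List.finRange n).flatMap fun i => g (Fin.natAdd m i) := by
  have h : List.finRange (m + n) = (List.finRange m).map (Fin.castAdd n)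
      ++ (List.finRange n).map (Fin.natAdd m) := by
    rw [← List.ofFn_id, List.ofFn_add, ← List.ofFn_eq_map, ← List.ofFn_eq_map]
    rfl
  rw [h, List.flatMap_append, List.flatMap_map, List.flatMap_map]

theorem agents_flatMap {β : Type} {n : ℕ} (F : AgentOf n → List β) :
    (List.finRange (agentCount n)).flatMap (fun i => F ((agentEquiv n).symm i))
      = ((List.finRange (n + 1)).flatMap fun i => (List.finRange (n + 1)).flatMap fun j =>
          F (.inl (i, j))) ++
        (((List.finRange n).flatMap fun i => F (.inr (.inl i))) ++
        ((List.finRange n).flatMap fun i => (List.finRange n).flatMap fun j =>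
          F (.inr (.inr (i, j))))) := by
  have e1 (i j) : (agentEquiv n).symm (Fin.castAdd _ (finProdFinEquiv (i, j)))
      = .inl (i, j) := (Equiv.symm_apply_eq _).2 rfl
  have e2 (i) : (agentEquiv n).symm (Fin.natAdd _ (Fin.castAdd _ i))
      = .inr (.inl i) := (Equiv.symm_apply_eq _).2 rfl
  have e3 (i j) : (agentEquiv n).symm (Fin.natAdd _ (Fin.natAdd _ (finProdFinEquiv (i, j))))
      = .inr (.inr (i, j)) := (Equiv.symm_apply_eq _).2 rfl
  refine (finRange_add_flatMap _).trans ?_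
  rw [finRange_add_flatMap, finRange_mul_flatMap, finRange_mul_flatMap]
  simp only [e1, e2, e3]

theorem agents_reverse_flatMap {β : Type} {n : ℕ} (F : AgentOf n → List β) :
    (List.finRange (agentCount n)).reverse.flatMap (fun i => F ((agentEquiv n).symm i))
      = ((List.finRange n).reverse.flatMap fun i => (List.finRange n).reverse.flatMap fun j =>
          F (.inr (.inr (i, j)))) ++
        (((List.finRange n).reverse.flatMap fun i => F (.inr (.inl i))) ++
        ((List.finRange (n + 1)).reverse.flatMap fun i =>
          (List.finRange (n + 1)).reverse.flatMap fun j => F (.inl (i, j)))) := by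
  have h := congrArg List.reverse (agents_flatMap fun a => (F a).reverse)
  simp only [List.reverse_append, List.reverse_flatMap, Function.comp_def, List.reverse_reverse,
    List.append_assoc] at h
  exact h

open Classical in
/-- The digraph of a graph, on the numbers of its vertices. -/
noncomputable def graphArc {n : ℕ} (G : SimpleGraph (Fin n)) (a b : Fin (agentCount n)) : Bool :=
  decide (gadgetArc G ((agentEquiv n).symm a) ((agentEquiv n).symm b))

theorem graphArc_asymm {n : ℕ} (G : SimpleGraph (Fin n)) (a b : Fin (agentCount n))
    (h : graphArc G a b = true) : graphArc G b a = false := by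
  simp only [graphArc, decide_eq_true_eq, decide_eq_false_iff_not] at h ⊢
  exact gadgetArc_asymm G _ _ h

theorem exists_equiv_graphArc_iff {n : ℕ} (G H : SimpleGraph (Fin n)) :
    (∃ f : Fin (agentCount n) ≃ Fin (agentCount n),
      ∀ a b, graphArc G a b = true → graphArc H (f b) (f a) = false) ↔ Nonempty (G ≃g H) := by
  -- The `(n + 1) * (n + 1)` gates outnumber the `n + n * n` other agents; being pairs of numbers,
  -- they can be enumerated by two nested loops.
  rw [← exists_equiv_gadgetArc_iff (Z := Fin (n + 1) × Fin (n + 1)) (by simp; nlinarith)]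
  simp only [graphArc, decide_eq_true_eq, decide_eq_false_iff_not]
  constructor
  · rintro ⟨f, hf⟩
    refine ⟨((agentEquiv n).trans f).trans (agentEquiv n).symm, fun a b h => ?_⟩
    have := hf (agentEquiv n a) (agentEquiv n b)
    simp only [Equiv.symm_apply_apply] at this
    exact this h
  · rintro ⟨f, hf⟩
    refine ⟨((agentEquiv n).symm.trans f).trans (agentEquiv n), fun a b h => ?_⟩
    simpa using hf _ _ h

/-- Even for `n = 0` there is one gate, so the bound `α` is positive. -/
theorem one_le_agentCount (n : ℕ) : 1 ≤ agentCount n := by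
  unfold agentCount
  nlinarith

/-- The instance constructed from two graphs. -/
noncomputable def reduction (I : GraphPair) : MultiLayerMarriage :=
  digraphMarriage (one_le_agentCount I.n) (graphArc I.H) (graphArc I.G)

/-- The agents of `W` carry the digraph of `H` and those of `U` that of `G`, so a perfect matching
is a bijection from the latter to the former. -/
theorem reduction_spec (I : GraphPair) :
    graphIsomorphism.IsYes I ↔ individuallyStableMarriage.IsYes (reduction I) :=
  (exists_equiv_graphArc_iff I.G I.H).symm.trans
    (exists_stable_iff (one_le_agentCount I.n) (graphArc_asymm I.H) (graphArc_asymm I.G)).symm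

theorem finProdFinEquiv_eq_mk {m n : ℕ} (i : Fin m) (j : Fin n) (h : i.val * n + j.val < m * n) :
    (⟨i.val * n + j.val, h⟩ : Fin (m * n)) = finProdFinEquiv (i, j) := by
  ext
  simp only [finProdFinEquiv, Equiv.coe_fn_mk]
  ring

open Classical in
theorem adjacencyWord_eq_ofFn {n : ℕ} (G : SimpleGraph (Fin n)) :
    adjacencyWord G = List.ofFn fun k : Fin (n * n) =>
      decide (G.Adj (finProdFinEquiv.symm k).1 (finProdFinEquiv.symm k).2) := by
  rw [List.ofFn_mul, adjacencyWord, concatFin]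
  simp only [finProdFinEquiv_eq_mk, Equiv.symm_apply_apply]

open Classical in
theorem adjacencyWord_getD {n : ℕ} (G : SimpleGraph (Fin n)) (x y : Fin n) (l : List Bool) :
    (adjacencyWord G ++ l).getD (x * n + y) false = decide (G.Adj x y) := by
  have hlt : x.val * n + y.val < n * n := by
    have hx := x.isLt
    have hy := y.isLt
    nlinarith
  have hlen : x.val * n + y.val < (adjacencyWord G).length := by
    rw [adjacencyWord_length]
    exact hlt
  rw [List.getD_append _ _ _ _ hlen, List.getD_eq_getElem _ _ hlen]
  simp only [adjacencyWord_eq_ofFn, List.getElem_ofFn, finProdFinEquiv_eq_mk,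
    Equiv.symm_apply_apply]

open Classical in
theorem eval_bit_encode (I : GraphPair) (ρ : Register → ℕ) (h0 : ρ 0 = I.n) (h : Bool)
    {x y : Register} {i j : Fin I.n} (hx : ρ x = i) (hy : ρ y = j) :
    (Test.bit h x y).eval (adjacencyWord I.G ++ adjacencyWord I.H) ρ
      = decide ((if h then I.H else I.G).Adj i j) := by
  simp only [Test.eval, h0, hx, hy]
  cases h with
  | false =>
    simp only [Bool.false_eq_true, if_false, zero_add]
    exact adjacencyWord_getD _ _ _ _
  | true =>
    simp only [if_true, add_assoc]
    have h1 := adjacencyWord_getD I.H i j []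
    rw [List.append_nil] at h1
    rw [← h1, List.getD_append_right _ _ _ _ (by rw [adjacencyWord_length]; omega),
      adjacencyWord_length]
    congr 1
    omega

/-! ## The generator of the constructed instance -/

/-- Boolean combinations of tests. -/
inductive Condition : Type
  | const (b : Bool) : Condition
  | test (a : Test) : Condition
  | and (c d : Condition) : Condition
  | or (c d : Condition) : Condition
  | not (c : Condition) : Condition

namespace Condition

/-- The truth value of a condition. -/
def eval (w : List Bool) (ρ : Register → ℕ) : Condition → Bool
  | const b => b
  | test a => a.eval w ρ
  | and c d => c.eval w ρ && d.eval w ρ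
  | or c d => c.eval w ρ || d.eval w ρ
  | not c => !c.eval w ρ

/-- All tests in the condition are valid. -/
def Valid : Condition → Prop
  | const _ => True
  | test a => a.Valid
  | and c d => c.Valid ∧ d.Valid
  | or c d => c.Valid ∧ d.Valid
  | not c => c.Valid

end Condition

namespace Generator

/-- Branch on a condition. -/
def cond : Condition → Generator → Generator → Generator
  | .const b, p, q => if b then p else q
  | .test a, p, q => ite a p q
  | .and c d, p, q => cond c (cond d p q) q
  | .or c d, p, q => cond c p (cond d p q)
  | .not c, p, q => cond c q p

theorem word_cond (w : List Bool) (ρ : Register → ℕ) (c : Condition) (p q : Generator) :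
    (cond c p q).word w ρ = if c.eval w ρ then p.word w ρ else q.word w ρ := by
  induction c generalizing p q with
  | const b => cases b <;> rfl
  | test a => rfl
  | and c d ihc ihd =>
    simp only [cond, ihc, ihd, Condition.eval, Bool.and_eq_true, ite_and]
  | or c d ihc ihd =>
    simp only [cond, ihc, ihd, Condition.eval, Bool.or_eq_true, ite_or]
  | not c ihc =>
    simp only [cond, ihc, Condition.eval]
    by_cases h : c.eval w ρ = true <;> simp [h]

theorem valid_cond {k : ℕ} {c : Condition} {p q : Generator} (hc : c.Valid) (hp : p.Valid k)
    (hq : q.Valid k) : (cond c p q).Valid k := by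
  induction c generalizing p q with
  | const b => cases b <;> assumption
  | test a => exact ⟨hc, hp, hq⟩
  | and c d ihc ihd => exact ihc hc.1 (ihd hc.2 hp hq) hq
  | or c d ihc ihd => exact ihc hc.1 hp (ihd hc.2 hp hq)
  | not c ihc => exact ihc hc hq hp

theorem Valid.mono {p : Generator} {j k : ℕ} (hp : p.Valid k) (h : j ≤ k) : p.Valid j := by
  induction p with
  | nothing => trivial
  | emit b => trivial
  | seq p q ihp ihq => exact ⟨ihp hp.1, ihq hp.2⟩
  | ite a p q ihp ihq => exact ⟨hp.1, ihp hp.2.1, ihq hp.2.2⟩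
  | forRange x x' y p ih => exact ⟨h.trans hp.1, hp.2⟩

end Generator

/-- The agents over registers. -/
inductive Agent (α : Type) : Type
  | gate (x y : α) : Agent α
  | vertex (x : α) : Agent α
  | pair (x y : α) : Agent α

namespace Agent

/-- Apply a function to the components of an agent. -/
def map {α β : Type} (f : α → β) : Agent α → Agent β
  | gate x y => gate (f x) (f y)
  | vertex x => vertex (f x)
  | pair x y => pair (f x) (f y)

/-- The registers that occur are among the first `k` ones. -/
def Below (k : ℕ) : Agent Register → Prop
  | gate x y => x.val < k ∧ y.val < k
  | vertex x => x.val < k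
  | pair x y => x.val < k ∧ y.val < k

/-- The agents as agents over numbers. -/
def ofAgentOf {n : ℕ} : AgentOf n → Agent ℕ
  | .inl (x, y) => gate x y
  | .inr (.inl x) => vertex x
  | .inr (.inr (x, y)) => pair x y

theorem Below.mono {a : Agent Register} {j k : ℕ} (h : a.Below j) (hjk : j ≤ k) : a.Below k := by
  cases a with
  | gate x y => exact ⟨h.1.trans_le hjk, h.2.trans_le hjk⟩
  | vertex x => exact Nat.lt_of_lt_of_le h hjk
  | pair x y => exact ⟨h.1.trans_le hjk, h.2.trans_le hjk⟩

theorem Below.map_eq {a : Agent Register} {k : ℕ} (h : a.Below k) {ρ ρ' : Register → ℕ}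
    (hρ : ∀ z : Register, z.val < k → ρ' z = ρ z) : a.map ρ' = a.map ρ := by
  cases a with
  | gate x y => simp only [map, hρ x h.1, hρ y h.2]
  | vertex x => simp only [map, hρ x h]
  | pair x y => simp only [map, hρ x h.1, hρ y h.2]

/-- The condition that two agents are equal. -/
def eqCondition : Agent Register → Agent Register → Condition
  | gate x y, gate x' y' => .and (.test (.eq x x')) (.test (.eq y y'))
  | vertex x, vertex x' => .test (.eq x x')
  | pair x y, pair x' y' => .and (.test (.eq x x')) (.test (.eq y y'))
  | _, _ => .const false

/-- The condition that there is an arc from the first agent to the second one. -/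
def arcCondition (h : Bool) : Agent Register → Agent Register → Condition
  | gate _ _, pair _ _ => .const true
  | vertex _, gate _ _ => .const true
  | vertex x, pair y z =>
    .or (.test (.eq x y)) (.and (.test (.eq x z)) (.test (.bit h y z)))
  | pair y z, vertex x =>
    .not (.or (.test (.eq x y)) (.and (.test (.eq x z)) (.test (.bit h y z))))
  | _, _ => .const false

/-- The condition that an agent belongs to part `k` of a preference list for an agent. -/
def rankCondition (h : Bool) (a b : Agent Register) : Bool → ℕ → Condition
  | false, 0 => eqCondition b a
  | false, 1 => .and (.not (eqCondition b a)) (arcCondition h a b)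
  | false, _ => .and (.not (eqCondition b a)) (.not (arcCondition h a b))
  | true, 1 => eqCondition b a
  | true, 2 => .and (.not (eqCondition b a)) (arcCondition h a b)
  | true, _ => .and (.not (eqCondition b a)) (.not (arcCondition h a b))

theorem eqCondition_valid {a b : Agent Register} (ha : a.Below 18) (hb : b.Below 18) :
    (eqCondition a b).Valid := by
  cases a <;> cases b <;> simp_all [eqCondition, Condition.Valid, Test.Valid, Below]

theorem arcCondition_valid (h : Bool) {a b : Agent Register} (ha : a.Below 18)
    (hb : b.Below 18) : (arcCondition h a b).Valid := by
  cases a <;> cases b <;> simp_all [arcCondition, Condition.Valid, Test.Valid, Below]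

theorem rankCondition_valid (h : Bool) {a b : Agent Register} (ha : a.Below 18)
    (hb : b.Below 18) (t : Bool) (k : ℕ) : (rankCondition h a b t k).Valid := by
  have h1 := eqCondition_valid hb ha
  have h2 := arcCondition_valid h ha hb
  unfold rankCondition
  split <;> simp_all [Condition.Valid]

theorem eval_eqCondition (w : List Bool) (ρ : Register → ℕ) {n : ℕ} {a b : Agent Register}
    {s t : AgentOf n} (ha : a.map ρ = ofAgentOf s) (hb : b.map ρ = ofAgentOf t) :
    (eqCondition a b).eval w ρ = decide (s = t) := by
  rcases a with ⟨x, y⟩ | ⟨x⟩ | ⟨x, y⟩ <;> rcases b with ⟨x', y'⟩ | ⟨x'⟩ | ⟨x', y'⟩ <;>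
    rcases s with ⟨i, j⟩ | i | ⟨i, j⟩ <;> rcases t with ⟨i', j'⟩ | i' | ⟨i', j'⟩ <;>
    simp_all [map, ofAgentOf, eqCondition, Condition.eval, Test.eval, Fin.ext_iff]

open Classical in
theorem eval_arcCondition (I : GraphPair) (ρ : Register → ℕ) (h0 : ρ 0 = I.n) (h : Bool)
    {a b : Agent Register} {s t : AgentOf I.n} (ha : a.map ρ = ofAgentOf s)
    (hb : b.map ρ = ofAgentOf t) :
    (arcCondition h a b).eval (adjacencyWord I.G ++ adjacencyWord I.H) ρ
      = decide (gadgetArc (if h then I.H else I.G) s t) := by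
  have hbit := fun {x y} {i j : Fin I.n} => eval_bit_encode I ρ h0 h (x := x) (y := y)
    (i := i) (j := j)
  have heq {x y : Register} {i j : Fin I.n} (hx : ρ x = i) (hy : ρ y = j) :
      (Test.eq x y).eval (adjacencyWord I.G ++ adjacencyWord I.H) ρ = decide (i = j) := by
    simp [Test.eval, hx, hy, Fin.ext_iff]
  rw [Bool.eq_iff_iff, decide_eq_true_eq]
  rcases a with ⟨x, y⟩ | ⟨x⟩ | ⟨x, y⟩ <;> rcases b with ⟨x', y'⟩ | ⟨x'⟩ | ⟨x', y'⟩ <;>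
    rcases s with ⟨i, j⟩ | i | ⟨i, j⟩ <;> rcases t with ⟨i', j'⟩ | i' | ⟨i', j'⟩ <;>
    simp only [map, ofAgentOf, reduceCtorEq, gate.injEq, vertex.injEq, pair.injEq] at ha hb <;>
    simp only [arcCondition, Condition.eval, gadgetArc, Bool.false_eq_true]
  -- Only the combinations of a vertex and a pair depend on the graph; the second one is the
  -- negation of the first.
  · simp [heq ha hb.1, heq ha hb.2, hbit hb.1 hb.2]
  · simp [heq hb ha.1, heq hb ha.2, hbit ha.1 ha.2]
    tauto

-- The last clause of `rankCondition` for each list accepts every remaining `k`; the bound `k < 3`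
-- makes it describe the part of the other agents exactly.
open Classical in
theorem eval_rankCondition (I : GraphPair) (ρ : Register → ℕ) (h0 : ρ 0 = I.n) (h : Bool)
    {a b : Agent Register} {s t : AgentOf I.n} (ha : a.map ρ = ofAgentOf s)
    (hb : b.map ρ = ofAgentOf t) (r : Bool) {k : ℕ} (hk : k < 3) :
    (rankCondition h a b r k).eval (adjacencyWord I.G ++ adjacencyWord I.H) ρ
      = decide (arcRank (graphArc (if h then I.H else I.G)) r (agentEquiv I.n s)
          (agentEquiv I.n t) = k) := by
  have h1 := eval_eqCondition (adjacencyWord I.G ++ adjacencyWord I.H) ρ hb ha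
  have h2 := eval_arcCondition I ρ h0 h ha hb
  have h3 : graphArc (if h then I.H else I.G) (agentEquiv I.n s) (agentEquiv I.n t)
      = decide (gadgetArc (if h then I.H else I.G) s t) := by
    simp [graphArc]
  have h4 : (agentEquiv I.n t = agentEquiv I.n s) = (t = s) := by simp
  interval_cases k <;> cases r <;>
    simp only [rankCondition, Condition.eval, h1, h2, arcRank, h3, h4] <;>
    by_cases h5 : t = s <;> by_cases h6 : gadgetArc (if h then I.H else I.G) s t <;>
    simp [h5, h6]

end Agent

/-! ### Loops over the agents -/

namespace Generator

open Function

variable (w : List Bool)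

theorem word_forRange {n : ℕ} (x x' y : Register) (p : Generator) (ρ : Register → ℕ)
    (hy : ρ y = n) (F : Fin n → List Bool)
    (h : ∀ i : Fin n, p.word w (update (update ρ x i) x' (n - 1 - i)) = F i) :
    (forRange x x' y p).word w ρ = (List.finRange n).flatMap F := by
  simp only [word, hy]
  rw [← List.map_coe_finRange_eq_range, List.flatMap_map]
  simp only [h]

/-- All loops write in increasing order of `x`; a decreasing order is obtained by reading the
complementary register `x'`. -/
theorem word_forRange_reverse {n : ℕ} (x x' y : Register) (p : Generator) (ρ : Register → ℕ)
    (hy : ρ y = n) (F : Fin n → List Bool)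
    (h : ∀ i : Fin n, p.word w (update (update ρ x (n - 1 - i)) x' i) = F i) :
    (forRange x x' y p).word w ρ = (List.finRange n).reverse.flatMap F := by
  rw [List.finRange_reverse, List.flatMap_map]
  refine word_forRange w x x' y p ρ hy _ fun i => ?_
  have e : (Fin.rev i).val = n - 1 - i := by
    rw [Fin.val_rev]
    omega
  have e' : n - 1 - (Fin.rev i).val = i := by omega
  rw [← h, e', e]

/-- Run `p` for all agents, in increasing or decreasing order. -/
def forAgents (r : Bool) (x x' y y' : Register) (p : Agent Register → Generator) : Generator :=
  match r with
  | false => seq (forRange x x' 1 (forRange y y' 1 (p (.gate x y))))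
      (seq (forRange x x' 0 (p (.vertex x))) (forRange x x' 0 (forRange y y' 0 (p (.pair x y)))))
  | true => seq (forRange x x' 0 (forRange y y' 0 (p (.pair x' y'))))
      (seq (forRange x x' 0 (p (.vertex x')))
        (forRange x x' 1 (forRange y y' 1 (p (.gate x' y')))))

theorem forAgents_valid (r : Bool) {k : ℕ} {x x' y y' : Register} (hx : k ≤ x.val)
    (h1 : 1 < x.val) (hxx' : x.val < x'.val) (hx'y : x'.val < y.val) (hyy' : y.val < y'.val)
    (hy' : y'.val < 18) {p : Agent Register → Generator}
    (hp : ∀ a, a.Below (y'.val + 1) → (p a).Valid (y'.val + 1)) :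
    (forAgents r x x' y y' p).Valid k := by
  have h0 : (0 : Register).val < x.val := by simp; omega
  have h0' : (0 : Register).val < y.val := by simp; omega
  have h1' : (1 : Register).val < x.val := h1
  have h1'' : (1 : Register).val < y.val := by simp; omega
  cases r with
  | false =>
    refine ⟨⟨hx, hxx', by omega, h1', by omega, hyy', hy', h1'', hp _ ⟨by omega, by omega⟩⟩,
      ⟨hx, hxx', by omega, h0, (hp _ ?_).mono (by omega)⟩,
      ⟨hx, hxx', by omega, h0, by omega, hyy', hy', h0', hp _ ⟨by omega, by omega⟩⟩⟩
    exact Nat.lt_succ_of_lt (by omega)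
  | true =>
    refine ⟨⟨hx, hxx', by omega, h0, by omega, hyy', hy', h0', hp _ ⟨by omega, by omega⟩⟩,
      ⟨hx, hxx', by omega, h0, (hp _ ?_).mono (by omega)⟩,
      ⟨hx, hxx', by omega, h1', by omega, hyy', hy', h1'', hp _ ⟨by omega, by omega⟩⟩⟩
    exact Nat.lt_succ_of_lt (by omega)

/-- The lexicographic numbering lists gates, vertices, pairs; its reversal takes the three blocks
backwards and uses the complementary registers. The body is only assumed correct for register
contents that agree with `ρ` below `x`, which is all that the loops preserve. -/
theorem word_forAgents {n : ℕ} (r : Bool) {x x' y y' : Register} (h1 : 1 < x.val)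
    (hxx' : x.val < x'.val) (hx'y : x'.val < y.val) (hyy' : y.val < y'.val)
    (p : Agent Register → Generator) (ρ : Register → ℕ) (hρ0 : ρ 0 = n) (hρ1 : ρ 1 = n + 1)
    (F : AgentOf n → List Bool)
    (h : ∀ (a : Agent Register) (ρ' : Register → ℕ) (s : AgentOf n), a.Below (y'.val + 1) →
      (∀ z : Register, z.val < x.val → ρ' z = ρ z) → a.map ρ' = Agent.ofAgentOf s →
      (p a).word w ρ' = F s) :
    (forAgents r x x' y y' p).word w ρ
      = (if r then (List.finRange (agentCount n)).reverse else List.finRange (agentCount n)).flatMap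
          fun i => F ((agentEquiv n).symm i) := by
  have ne {a b : Register} (h : a.val < b.val) : a ≠ b := by
    rintro rfl
    omega
  have e1 : x ≠ x' := ne hxx'
  have e2 : x ≠ y := ne (by omega)
  have e3 : x ≠ y' := ne (by omega)
  have e4 : x' ≠ y := ne (by omega)
  have e5 : x' ≠ y' := ne (by omega)
  have e6 : y ≠ y' := ne (by omega)
  have low (z : Register) (hz : z.val < x.val) (i i' j j' : ℕ) :
      update (update ρ x i) x' i' z = ρ z ∧
      update (update (update (update ρ x i) x' i') y j) y' j' z = ρ z := by
    have z1 : z ≠ x := ne hz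
    have z2 : z ≠ x' := ne (by omega)
    have z3 : z ≠ y := ne (by omega)
    have z4 : z ≠ y' := ne (by omega)
    simp [z1, z2, z3, z4]
  have hz0 : (0 : Register).val < x.val := by simp; omega
  have hz1 : (1 : Register).val < x.val := h1
  have below {k : Register} (hk : k = x ∨ k = x' ∨ k = y ∨ k = y') : k.val < y'.val + 1 := by
    rcases hk with rfl | rfl | rfl | rfl <;> omega
  cases r with
  | false =>
    simp only [Bool.false_eq_true, if_false]
    rw [agents_flatMap]
    simp only [forAgents, word.eq_3]
    congr 1
    · refine word_forRange w _ _ _ _ _ hρ1 _ fun i => ?_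
      refine word_forRange w _ _ _ _ _ ((low 1 hz1 _ _ 0 0).1.trans hρ1) _ fun j => ?_
      refine h _ _ _ ⟨below (by simp), below (by simp)⟩ (fun z hz => (low z hz _ _ _ _).2) ?_
      simp [Agent.map, Agent.ofAgentOf, update, e1, e2, e3, e6]
    congr 1
    · refine word_forRange w _ _ _ _ _ hρ0 _ fun i => ?_
      refine h _ _ _ (below (by simp)) (fun z hz => (low z hz _ _ 0 0).1) ?_
      simp [Agent.map, Agent.ofAgentOf, update, e1]
    · refine word_forRange w _ _ _ _ _ hρ0 _ fun i => ?_
      refine word_forRange w _ _ _ _ _ ((low 0 hz0 _ _ 0 0).1.trans hρ0) _ fun j => ?_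
      refine h _ _ _ ⟨below (by simp), below (by simp)⟩ (fun z hz => (low z hz _ _ _ _).2) ?_
      simp [Agent.map, Agent.ofAgentOf, update, e1, e2, e3, e6]
  | true =>
    simp only [if_true]
    rw [agents_reverse_flatMap]
    simp only [forAgents, word.eq_3]
    congr 1
    · refine word_forRange_reverse w _ _ _ _ _ hρ0 _ fun i => ?_
      refine word_forRange_reverse w _ _ _ _ _ ((low 0 hz0 _ _ 0 0).1.trans hρ0) _ fun j => ?_
      refine h _ _ _ ⟨below (by simp), below (by simp)⟩ (fun z hz => (low z hz _ _ _ _).2) ?_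
      simp [Agent.map, Agent.ofAgentOf, update, e4, e5]
    congr 1
    · refine word_forRange_reverse w _ _ _ _ _ hρ0 _ fun i => ?_
      refine h _ _ _ (below (by simp)) (fun z hz => (low z hz _ _ 0 0).1) ?_
      simp [Agent.map, Agent.ofAgentOf, update]
    · refine word_forRange_reverse w _ _ _ _ _ hρ1 _ fun i => ?_
      refine word_forRange_reverse w _ _ _ _ _ ((low 1 hz1 _ _ 0 0).1.trans hρ1) _ fun j => ?_
      refine h _ _ _ ⟨below (by simp), below (by simp)⟩ (fun z hz => (low z hz _ _ _ _).2) ?_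
      simp [Agent.map, Agent.ofAgentOf, update, e4, e5]

end Generator

/-! ### The generator of the instance word -/

namespace Generator

open Function

variable (w : List Bool)

/-- Write as many ones as the value of a register. -/
def ones (y : Register) : Generator := forRange 14 15 y (emit true)

/-- Write as many ones as the product of two registers. -/
def onesMul (x y : Register) : Generator := forRange 14 15 x (forRange 16 17 y (emit true))

theorem word_ones (y : Register) (ρ : Register → ℕ) :
    (ones y).word w ρ = List.replicate (ρ y) true := by
  simp only [ones, word]
  induction ρ y with
  | zero => rfl
  | succ k ih =>
    rw [List.range_succ, List.flatMap_append, ih, List.replicate_succ']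
    rfl

/-- The inner loop reads `y` after registers `14` and `15` have been overwritten, hence the bound on
`y`. -/
theorem word_onesMul {y : Register} (hy : y.val < 14) (x : Register) (ρ : Register → ℕ) :
    (onesMul x y).word w ρ = List.replicate (ρ x * ρ y) true := by
  have h1 : y ≠ 14 := by rintro rfl; simp at hy
  have h2 : y ≠ 15 := by rintro rfl; simp at hy
  have h (ρ' : Register → ℕ) : (forRange 16 17 y (emit true)).word w ρ'
      = List.replicate (ρ' y) true := word_ones w y ρ'
  unfold onesMul word
  simp only [h, update_of_ne h1, update_of_ne h2]
  induction ρ x with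
  | zero => simp
  | succ k ih =>
    rw [List.range_succ, List.flatMap_append, ih, add_mul, List.replicate_add]
    simp

/-- Write the number of an agent in unary. -/
def index : Agent Register → Generator
  | .gate x y => seq (onesMul 1 x) (seq (ones y) (emit false))
  | .vertex x => seq (onesMul 1 1) (seq (ones x) (emit false))
  | .pair x y => seq (onesMul 1 1) (seq (ones 0) (seq (onesMul 0 x) (seq (ones y) (emit false))))

/-- The number of an agent is its offset in its block, row by row, plus the sizes `(n + 1) * (n +
1)` and `n` of the blocks before it; sums are written by concatenating runs of ones. -/
theorem word_index {n : ℕ} {a : Agent Register} (hb : a.Below 14) (ρ : Register → ℕ)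
    (hρ0 : ρ 0 = n) (hρ1 : ρ 1 = n + 1) {s : AgentOf n} (ha : a.map ρ = Agent.ofAgentOf s) :
    (index a).word w ρ = unaryWord (agentEquiv n s) := by
  rcases a with ⟨x, y⟩ | ⟨x⟩ | ⟨x, y⟩ <;> rcases s with ⟨i, j⟩ | i | ⟨i, j⟩ <;>
    simp only [Agent.map, Agent.ofAgentOf, reduceCtorEq, Agent.gate.injEq, Agent.vertex.injEq,
      Agent.pair.injEq] at ha
  · have e : (agentEquiv n (.inl (i, j))).val = (n + 1) * i + j :=
      Nat.add_comm _ _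
    simp only [index, word, word_ones, word_onesMul w hb.1, hρ1, ha, e, unaryWord,
      List.replicate_add, List.append_assoc]
  · have e : (agentEquiv n (.inr (.inl i))).val = (n + 1) * (n + 1) + i := rfl
    simp only [index, word, word_ones, word_onesMul w (y := 1) (by decide), hρ1, ha, e, unaryWord,
      List.replicate_add, List.append_assoc]
  · have e : (agentEquiv n (.inr (.inr (i, j)))).val
        = (n + 1) * (n + 1) + (n + (n * i + j)) := by
      rw [add_comm (n * i.val)]
      rfl
    simp only [index, word, word_ones, word_onesMul w (y := 1) (by decide), word_onesMul w hb.1,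
      hρ0, hρ1, ha, e, unaryWord, List.replicate_add, List.append_assoc]

theorem ones_valid {y : Register} (hy : y.val < 14) {k : ℕ} (hk : k ≤ 14) :
    (ones y).Valid k :=
  ⟨hk, by decide, by decide, hy, trivial⟩

theorem onesMul_valid {x y : Register} (hx : x.val < 14) (hy : y.val < 14) {k : ℕ}
    (hk : k ≤ 14) : (onesMul x y).Valid k :=
  ⟨hk, by decide, by decide, hx, le_rfl, by decide, by decide, Nat.lt_of_lt_of_le hy (by decide),
    trivial⟩

theorem index_valid {a : Agent Register} (ha : a.Below 14) : (index a).Valid 14 := by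
  have h0 : (0 : Register).val < 14 := by decide
  have h1 : (1 : Register).val < 14 := by decide
  cases a with
  | gate x y => exact ⟨onesMul_valid h1 ha.1 le_rfl, ones_valid ha.2 le_rfl, trivial⟩
  | vertex x => exact ⟨onesMul_valid h1 h1 le_rfl, ones_valid ha le_rfl, trivial⟩
  | pair x y => exact ⟨onesMul_valid h1 h1 le_rfl, ones_valid h0 le_rfl,
      onesMul_valid h0 ha.1 le_rfl, ones_valid ha.2 le_rfl, trivial⟩

/-- Write part `k` of a preference list for agent `a`. -/
def part (h : Bool) (a : Agent Register) (r : Bool) (k : ℕ) : Generator :=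
  forAgents r 10 11 12 13 fun b => cond (Agent.rankCondition h a b r k) (index b) nothing

/-- Write a preference list for agent `a` once for each agent. -/
def prefLists (h : Bool) (r : Bool) (a : Agent Register) : Generator :=
  forAgents false 6 7 8 9 fun _ => seq (part h a r 0) (seq (part h a r 1) (part h a r 2))

/-- Write as many ones as there are agents. -/
def onesAgents : Generator := seq (onesMul 1 1) (seq (ones 0) (onesMul 0 0))

/-- Write the encoding of the constructed instance. -/
def instanceWord : Generator :=
  seq (seq onesAgents (emit false)) (seq (seq onesAgents (seq onesAgents (emit false)))
    (seq (seq onesAgents (emit false))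
      (forAgents false 2 3 4 5 fun a =>
        seq (seq (prefLists true false a) (prefLists false false a))
          (seq (prefLists true true a) (prefLists false true a)))))

/-- Registers are allotted by nesting depth: `2`–`5` for the agent that defines the layer pair,
`6`–`9` for repetitions of a list, `10`–`13` for the agent being listed, `14`–`17` for unary output.
-/
theorem part_valid (h : Bool) {a : Agent Register} (ha : a.Below 6) (r : Bool) (k : ℕ) :
    (part h a r k).Valid 10 :=
  forAgents_valid r le_rfl (by decide) (by decide) (by decide) (by decide) (by decide)
    fun b hb => valid_cond
      (Agent.rankCondition_valid h (ha.mono (by decide)) (hb.mono (by decide)) r k)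
      (index_valid hb) trivial

theorem prefLists_valid (h r : Bool) {a : Agent Register} (ha : a.Below 6) :
    (prefLists h r a).Valid 6 :=
  forAgents_valid false le_rfl (by decide) (by decide) (by decide) (by decide) (by decide)
    fun _ _ => ⟨part_valid h ha r 0, part_valid h ha r 1, part_valid h ha r 2⟩

theorem onesAgents_valid : onesAgents.Valid 2 :=
  ⟨onesMul_valid (by decide) (by decide) (by decide), ones_valid (by decide) (by decide),
    onesMul_valid (by decide) (by decide) (by decide)⟩

theorem instanceWord_valid : instanceWord.Valid 2 :=
  ⟨⟨onesAgents_valid, trivial⟩, ⟨onesAgents_valid, onesAgents_valid, trivial⟩,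
    ⟨onesAgents_valid, trivial⟩,
    forAgents_valid false le_rfl (by decide) (by decide) (by decide) (by decide) (by decide)
      fun _ ha => ⟨⟨prefLists_valid true false ha, prefLists_valid false false ha⟩,
        prefLists_valid true true ha, prefLists_valid false true ha⟩⟩

theorem word_onesAgents {n : ℕ} (ρ : Register → ℕ) (hρ0 : ρ 0 = n) (hρ1 : ρ 1 = n + 1) :
    onesAgents.word w ρ = List.replicate (agentCount n) true := by
  simp only [onesAgents, word, word_ones, word_onesMul w (y := 1) (by decide),
    word_onesMul w (y := 0) (by decide), hρ0, hρ1, agentCount, List.replicate_add]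

theorem flatMap_filter_eq {α β : Type} (l : List α) (p : α → Bool) (g : α → List β) :
    (l.filter p).flatMap g = l.flatMap fun a => if p a then g a else [] := by
  induction l with
  | nil => rfl
  | cons a l ih =>
    rw [List.filter_cons, List.flatMap_cons, ← ih]
    split_ifs <;> simp

/-- No sorting is required: each of the three parts is a filter of the enumeration of the agents, so
one pass over all agents with a test writes it. -/
theorem word_part (I : GraphPair) (h : Bool) {a : Agent Register} (ha : a.Below 10) (r : Bool)
    {k : ℕ} (hk : k < 3) (ρ : Register → ℕ) (hρ0 : ρ 0 = I.n) (hρ1 : ρ 1 = I.n + 1)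
    {s : AgentOf I.n} (hs : a.map ρ = Agent.ofAgentOf s) :
    (part h a r k).word (adjacencyWord I.G ++ adjacencyWord I.H) ρ
      = ((if r then (List.finRange (agentCount I.n)).reverse
          else List.finRange (agentCount I.n)).filter fun i =>
            arcRank (graphArc (if h then I.H else I.G)) r (agentEquiv I.n s) i = k).flatMap
          fun i => unaryWord i.val := by
  rw [flatMap_filter_eq, part, word_forAgents (n := I.n) _ r (by decide) (by decide) (by decide)
    (by decide) _ ρ hρ0 hρ1 fun t =>
      if arcRank (graphArc (if h then I.H else I.G)) r (agentEquiv I.n s) (agentEquiv I.n t) = k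
        then unaryWord (agentEquiv I.n t).val else []]
  · simp
  · intro b ρ' t hb hρ' ht
    have h0 := (hρ' 0 (by decide)).trans hρ0
    have h1 := (hρ' 1 (by decide)).trans hρ1
    have hs' := (ha.map_eq hρ').trans hs
    rw [word_cond, Agent.eval_rankCondition I ρ' h0 h hs' ht r hk, word_index _ hb ρ' h0 h1 ht]
    simp [word]

theorem word_prefLists (I : GraphPair) (h r : Bool) {a : Agent Register} (ha : a.Below 6)
    (ρ : Register → ℕ) (hρ0 : ρ 0 = I.n) (hρ1 : ρ 1 = I.n + 1)
    {s : AgentOf I.n} (hs : a.map ρ = Agent.ofAgentOf s) :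
    (prefLists h r a).word (adjacencyWord I.G ++ adjacencyWord I.H) ρ
      = repeatedWord (arcList (graphArc (if h then I.H else I.G)) r (agentEquiv I.n s)) := by
  rw [prefLists, word_forAgents (n := I.n) _ false (by decide) (by decide) (by decide)
    (by decide) _ ρ hρ0 hρ1 fun _ =>
      (arcList (graphArc (if h then I.H else I.G)) r (agentEquiv I.n s)).flatMap
        fun i => unaryWord i.val]
  · rfl
  · intro b ρ' t hb hρ' ht
    have h0 := (hρ' 0 (by decide)).trans hρ0
    have h1 := (hρ' 1 (by decide)).trans hρ1
    have hs' := (ha.map_eq hρ').trans hs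
    have ha' : a.Below 10 := ha.mono (by decide)
    simp only [word, word_part I h ha' r (show 0 < 3 by decide) ρ' h0 h1 hs',
      word_part I h ha' r (show 1 < 3 by decide) ρ' h0 h1 hs',
      word_part I h ha' r (show 2 < 3 by decide) ρ' h0 h1 hs', arcList, List.sortByKey,
      List.flatMap_append]

theorem word_instanceWord (I : GraphPair) :
    (reduction I).encode
      = instanceWord.word (adjacencyWord I.G ++ adjacencyWord I.H) (initialReg I.n) := by
  have hρ0 : initialReg I.n 0 = I.n := by simp [initialReg, update]
  have hρ1 : initialReg I.n 1 = I.n + 1 := by simp [initialReg]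
  rw [reduction, encode_digraphMarriage]
  -- By `mul_two` the number of layers is two runs of `agentCount` ones.
  simp only [instanceWord, word, word_onesAgents _ _ hρ0 hρ1, unaryWord, mul_two,
    List.replicate_add, List.append_assoc]
  rw [word_forAgents (n := I.n) _ false (by decide) (by decide) (by decide)
    (by decide) _ _ hρ0 hρ1 fun s =>
      repeatedWord (arcList (graphArc I.H) false (agentEquiv I.n s)) ++
      (repeatedWord (arcList (graphArc I.G) false (agentEquiv I.n s)) ++
      (repeatedWord (arcList (graphArc I.H) true (agentEquiv I.n s)) ++
        repeatedWord (arcList (graphArc I.G) true (agentEquiv I.n s))))]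
  · simp
  · intro a ρ s ha hρ hs
    have h0 := (hρ 0 (by decide)).trans hρ0
    have h1 := (hρ 1 (by decide)).trans hρ1
    simp only [word, word_prefLists I _ _ ha ρ h0 h1 hs, List.append_assoc, if_true,
      Bool.false_eq_true, if_false]

end Generator

/-! ### The polynomial-time reduction -/

theorem mainTheorem10 :
    graphIsomorphism.PolyTimeReducible
      (individuallyStableMarriage.restrict fun I : MultiLayerMarriage =>
        I.Uniform ∧ Even I.layers ∧ I.alpha = I.layers / 2) := by
  refine ⟨fun I => ⟨reduction I, digraphMarriage_uniform _ _ _, ⟨agentCount I.n, mul_two _⟩,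
    (Nat.mul_div_cancel (agentCount I.n) two_pos).symm⟩, ?_, reduction_spec⟩
  exact Generator.nonempty_computable Generator.instanceWord Generator.instanceWord_valid
    (fun I : GraphPair => I.n) (fun I => adjacencyWord I.G ++ adjacencyWord I.H) (fun _ => rfl)
    Generator.word_instanceWord
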